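/- Let $p_0,\dots,p_{n-1}\in\mathbb{R}^2$ be the points of $n$ events, ordered by time. Let $T$ be the balanced binary tree over time whose leaves, all at the same depth, are the events in order; level by level, consecutive nodes $2m,2m+1$ have a common parent (the last node of a level may be an only child). The canonical subset $C_v$ of a node $v$ is the set of events at the leaves below $v$. Each node has pointers to its parent, its children, and the previous and next node of the same depth; an array gives the leaf of each event; and the sub-hull of a node $v$, that is, the vertices of the convex hull of the points of $C_v$, is stored at $v$ in an array in clockwise order beginning with the lexicographic maximum, with the number of vertices and the index of the lexicographic minimum. The cost model is a real RAM (unit cost for memory access, comparisons, arithmetic $+,-,\times$ on reals and $+,-,\lfloor\cdot/2\rfloor$ on integers). There are, for each of the two directions (clockwise, counterclockwise), a fixed program and an absolute constant $C$ such that the following holds for every $n$ and every time window $[p_i,p_j]$, $0\le i<j<n$, with $w=j-i+1$ events. There is a set $N$ of at most $C\log w$ nodes of $T$ (the canonical cover of the window, depending only on $n,i,j$) whose canonical subsets have union $\{i,\dots,j\}$, such that for all points $p_0,\dots,p_{n-1}$, for every memory in which $T$ is stored, with the sub-hulls of the nodes in $N$ (the canonical sub-hulls; the memory may hold anything in place of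 the other sub-hulls), and for every point $q$ on the boundary of the convex hull $H$ of $\{p_i,\dots,p_j\}$, $H\neq\{q\}$, the program, given $i$, $j$, $q$ and the address of the leaf array, halts after at most $C\log^2 w$ steps and outputs the neighbor of $q$ on $H$ in the given direction: a vertex $v\ne q$ of $H$ such that all points $p_i,\dots,p_j$ lie on or to the right (clockwise), respectively on or to the left (counterclockwise), of the directed line from $q$ to $v$. -/

import Mathlib

namespace GiftWrap

/-! ### The machine: a real RAM with read-only memory, run by structured programs

A program has finitely many integer and real registers and may read, but not write, an integer
memory and a real memory.  Every constant, register access, memory access, arithmetic operation,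
comparison, Boolean connective, assignment and branching costs one step. -/

/-- The random access memory holding the data structure. -/
structure Memory where
  int : ℤ → ℤ
  real : ℤ → ℝ

/-- The contents of the registers. -/
structure State where
  int : ℕ → ℤ
  real : ℕ → ℝ

/-- Integer expressions; `load a` is the content of the integer memory at address `a`, and `half a`
is `a / 2` rounded down. -/
inductive IExpr where
  | const (c : ℤ)
  | reg (x : ℕ)
  | load (a : IExpr)
  | add (a b : IExpr)
  | sub (a b : IExpr)
  | half (a : IExpr)

/-- Real expressions; constants are integers, and `load a` is the content of the real memory at
the (integer) address `a`. -/
inductive RExpr where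
  | const (c : ℤ)
  | reg (x : ℕ)
  | load (a : IExpr)
  | add (a b : RExpr)
  | sub (a b : RExpr)
  | mul (a b : RExpr)

/-- Tests. -/
inductive Test where
  | ile (a b : IExpr)
  | rle (a b : RExpr)
  | not (b : Test)
  | and (b c : Test)

/-- Programs. -/
inductive Prog where
  | skip
  | setInt (x : ℕ) (e : IExpr)
  | setReal (x : ℕ) (e : RExpr)
  | seq (P Q : Prog)
  | ite (b : Test) (P Q : Prog)
  | loop (b : Test) (P : Prog)

/-- Value of an integer expression. -/
def IExpr.eval (M : Memory) (s : State) : IExpr → ℤ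
  | .const c => c
  | .reg x => s.int x
  | .load a => M.int (a.eval M s)
  | .add a b => a.eval M s + b.eval M s
  | .sub a b => a.eval M s - b.eval M s
  | .half a => a.eval M s / 2

/-- Number of steps for evaluating an integer expression. -/
def IExpr.cost : IExpr → ℕ
  | .const _ => 1
  | .reg _ => 1
  | .load a => a.cost + 1
  | .add a b => a.cost + b.cost + 1
  | .sub a b => a.cost + b.cost + 1
  | .half a => a.cost + 1

/-- Value of a real expression. -/
noncomputable def RExpr.eval (M : Memory) (s : State) : RExpr → ℝ
  | .const c => (c : ℝ)
  | .reg x => s.real x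
  | .load a => M.real (a.eval M s)
  | .add a b => a.eval M s + b.eval M s
  | .sub a b => a.eval M s - b.eval M s
  | .mul a b => a.eval M s * b.eval M s

/-- Number of steps for evaluating a real expression. -/
def RExpr.cost : RExpr → ℕ
  | .const _ => 1
  | .reg _ => 1
  | .load a => a.cost + 1
  | .add a b => a.cost + b.cost + 1
  | .sub a b => a.cost + b.cost + 1
  | .mul a b => a.cost + b.cost + 1

/-- Truth of a test. -/
def Test.holds (M : Memory) (s : State) : Test → Prop
  | .ile a b => a.eval M s ≤ b.eval M s
  | .rle a b => a.eval M s ≤ b.eval M s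
  | .not b => ¬ b.holds M s
  | .and b c => b.holds M s ∧ c.holds M s

/-- Number of steps for evaluating a test. -/
def Test.cost : Test → ℕ
  | .ile a b => a.cost + b.cost + 1
  | .rle a b => a.cost + b.cost + 1
  | .not b => b.cost + 1
  | .and b c => b.cost + c.cost + 1

/-- `Run M P s t s'`: with memory `M`, the program `P` started with registers `s` halts after
exactly `t` steps with registers `s'`. -/
inductive Run (M : Memory) : Prog → State → ℕ → State → Prop
  | skip (s : State) : Run M .skip s 1 s
  | setInt (x : ℕ) (e : IExpr) (s : State) :
      Run M (.setInt x e) s (e.cost + 1) { s with int := Function.update s.int x (e.eval M s) }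
  | setReal (x : ℕ) (e : RExpr) (s : State) :
      Run M (.setReal x e) s (e.cost + 1) { s with real := Function.update s.real x (e.eval M s) }
  | seq {P Q : Prog} {s s₁ s₂ : State} {t₁ t₂ : ℕ} :
      Run M P s t₁ s₁ → Run M Q s₁ t₂ s₂ → Run M (.seq P Q) s (t₁ + t₂) s₂
  | iteTrue {b : Test} {P Q : Prog} {s s' : State} {t : ℕ} :
      b.holds M s → Run M P s t s' → Run M (.ite b P Q) s (b.cost + 1 + t) s'
  | iteFalse {b : Test} {P Q : Prog} {s s' : State} {t : ℕ} :
      ¬ b.holds M s → Run M Q s t s' → Run M (.ite b P Q) s (b.cost + 1 + t) s'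
  | loopDone {b : Test} {P : Prog} {s : State} :
      ¬ b.holds M s → Run M (.loop b P) s (b.cost + 1) s
  | loopStep {b : Test} {P : Prog} {s s₁ s₂ : State} {t₁ t₂ : ℕ} :
      b.holds M s → Run M P s t₁ s₁ → Run M (.loop b P) s₁ t₂ s₂ →
      Run M (.loop b P) s (b.cost + 1 + t₁ + t₂) s₂

/-! ### Planar convex hulls -/

/-- Twice the signed area of the triangle `a b c`: positive if `c` lies to the left of the directed
line from `a` to `b`, negative if it lies to the right, and zero if it lies on the line. -/
def orient (a b c : ℝ × ℝ) : ℝ :=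
  (b.1 - a.1) * (c.2 - a.2) - (b.2 - a.2) * (c.1 - a.1)

/-- The vertices of the convex hull of a set of points. -/
def hullVertices (S : Set (ℝ × ℝ)) : Set (ℝ × ℝ) :=
  (convexHull ℝ S).extremePoints ℝ

/-- `v 0, …, v (h - 1)` are the vertices of the convex hull of `S`, without repetition, in
clockwise order, beginning with the lexicographic maximum; `l` is the index of the lexicographic
minimum. -/
structure IsHullArray (S : Set (ℝ × ℝ)) (h l : ℕ) (v : ℕ → ℝ × ℝ) : Prop where
  vertices : v '' Set.Iio h = hullVertices S
  distinct : Set.InjOn v (Set.Iio h)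
  clockwise : ∀ a b c, a < b → b < c → c < h → orient (v a) (v b) (v c) < 0
  first_max : ∀ x ∈ S, toLex x ≤ toLex (v 0)
  min_index : l < h
  min_min : ∀ x ∈ S, toLex (v l) ≤ toLex x

/-- The two senses of rotation. -/
inductive Direction where
  | clockwise
  | counterclockwise

/-- `v` is the next vertex after the boundary point `q` on the convex hull of `S`, in the given
sense: a hull vertex other than `q` such that all points of `S` are on or to the right (clockwise),
respectively on or to the left (counterclockwise), of the directed line from `q` to `v`. -/
def IsHullNeighbor : Direction → Set (ℝ × ℝ) → ℝ × ℝ → ℝ × ℝ → Prop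
  | .clockwise, S, q, v => v ∈ hullVertices S ∧ v ≠ q ∧ ∀ x ∈ S, orient q v x ≤ 0
  | .counterclockwise, S, q, v => v ∈ hullVertices S ∧ v ≠ q ∧ ∀ x ∈ S, 0 ≤ orient q v x

/-! ### The decomposition tree over the events `0, …, n - 1`

All leaves have the same depth.  A node is a pair `(k, m)`, where `k` is its height above the
leaves and `m` its position among the nodes of height `k`, counted from `0`.  The leaf of the event
`t` is `(0, t)`; the children of `(k + 1, m)` are `(k, 2 * m)` and, if it exists, `(k, 2 * m + 1)`;
the root is `(Nat.clog 2 n, 0)`. -/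

/-- The nodes of the tree. -/
def IsNode (n : ℕ) (v : ℕ × ℕ) : Prop :=
  v.1 ≤ Nat.clog 2 n ∧ v.2 * 2 ^ v.1 < n

/-- The events at the leaves below a node. -/
def canonicalSubset (n : ℕ) (v : ℕ × ℕ) : Finset ℕ :=
  Finset.Ico (v.2 * 2 ^ v.1) (min ((v.2 + 1) * 2 ^ v.1) n)

/-- The tree over `n` events, with its links, is stored in the memory: the record of the node `v`
is at address `addr v`, and the array of the leaves begins at address `A`.  The cells `0` to `4` of
a record hold the addresses of the parent, of the left and the right child, and (the level links)
of the previous and the next node of the same depth.  Nothing is said about the cell of a link whose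
target does not exist. -/
structure StoresTree (M : Memory) (A : ℤ) (n : ℕ) (addr : ℕ × ℕ → ℤ) : Prop where
  leaf : ∀ t < n, M.int (A + t) = addr (0, t)
  parent : ∀ k m, IsNode n (k, m) → IsNode n (k + 1, m / 2) →
    M.int (addr (k, m)) = addr (k + 1, m / 2)
  left : ∀ k m, IsNode n (k + 1, m) → M.int (addr (k + 1, m) + 1) = addr (k, 2 * m)
  right : ∀ k m, IsNode n (k + 1, m) → IsNode n (k, 2 * m + 1) →
    M.int (addr (k + 1, m) + 2) = addr (k, 2 * m + 1)
  prev : ∀ k m, IsNode n (k, m + 1) → M.int (addr (k, m + 1) + 3) = addr (k, m)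
  next : ∀ k m, IsNode n (k, m + 1) → M.int (addr (k, m) + 4) = addr (k, m + 1)

/-- The convex hull of `S` is stored at the record with address `a`: the cells `5`, `6` and `7` of
the record hold the number of hull vertices, the index of the lexicographically minimal one, and
the address in the real memory of an array with the coordinates of the vertices in clockwise order
from the lexicographic maximum. -/
def StoresHull (M : Memory) (a : ℤ) (S : Set (ℝ × ℝ)) : Prop :=
  ∃ (h l : ℕ) (v : ℕ → ℝ × ℝ), IsHullArray S h l v ∧
    M.int (a + 5) = h ∧ M.int (a + 6) = l ∧
    ∀ k < h, M.real (M.int (a + 7) + 2 * k) = (v k).1 ∧ M.real (M.int (a + 7) + 2 * k + 1) = (v k).2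

/-- The registers at the start of a query: the integer registers `0`, `1`, `2` hold the address of
the array of the leaves and the first and last event of the window, the real registers `0`, `1` hold
the coordinates of the query point, and all other registers are `0`. -/
def queryStart (A : ℤ) (i j : ℕ) (q : ℝ × ℝ) : State where
  int x := if x = 0 then A else if x = 1 then (i : ℤ) else if x = 2 then (j : ℤ) else 0
  real x := if x = 0 then q.1 else if x = 1 then q.2 else 0

end GiftWrap

/-!
The window is covered by `O(log w)` nodes of the tree, found by walking up from the two ends of the
window at once (`coverNodes`): on each level, the left end of the current row of nodes is split off
if it is a right child, the right end if it is a left child, and the rest is replaced by the row of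
parents.  A hull vertex of the window is a hull vertex of some node of the cover, and the neighbor
of a boundary point `q` is a tangent point from `q` (`IsTangentPoint`): all points lie on one side
of the line through `q` and it, and none lies beyond it.  A tangent point of the window is one of
every node whose point set contains it, so it suffices to find the tangent points of the nodes and
to choose the best of them.

*Tangent point of one node.*  The lexicographic maximum and minimum split the hull into two chains,
each monotone with respect to the lexicographic order, which on finitely many points is the order of
a linear form (`exists_linForm_lt_iff_lex`).  On such a chain a simple test, which compares a vertex
with `q` and asks on which side of the next edge `q` lies, is true exactly before the tangent point
(`chain_step_iff`); the proof is the affine dependence of four points, with signed areas as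
coefficients.  So binary search takes `O(log w)` steps for each node, whether or not `q` is a point
of that node.  The ends of the chains are tried separately.

*Choosing the best.*  The window lies in a closed half-plane bounded by a line through `q`, where
directions are compared by orientation, and equal directions by distance.  This comparison
(`Improves`) is transitive except for pairs of opposite directions along the boundary, which
orientation cannot tell apart.  A first candidate in the last of all directions may therefore hide
the best one in the opposite direction.  If the candidates do not lie on one line, then such a
candidate is displaced in the course of one pass, and a second pass finds the best one
(`foldl_better_append_self`).  To make sure of this, three vertices that are not on a line are
offered from every node that has them (`IsHullArray.collinear`); and if all points lie on one line,
then each of the two ends of the hull is a valid answer (`isTangentPoint_foldl_better`).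

*The program.*  `Offers` is a Hoare triple with a time bound for programs that compare a sequence of
candidates with the best one so far.  The sequence does not depend on the best one, nor on what the
registers other than those in the precondition hold, so that both passes offer the same candidates.
-/

namespace GiftWrap

/-! ### Signed areas and convex chains -/

/-- The linear form with coefficients `α`, `β`. -/
def linForm (α β : ℝ) (x : ℝ × ℝ) : ℝ := α * x.1 + β * x.2

/-- The inner product of the vectors from `q` to `x` and from `q` to `y`. -/
def dotAt (q x y : ℝ × ℝ) : ℝ := (x.1 - q.1) * (y.1 - q.1) + (x.2 - q.2) * (y.2 - q.2)

/-- The affine dependence of four points of the plane, with signed areas as coefficients. -/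
lemma orient_linForm (α β : ℝ) (a b c d : ℝ × ℝ) :
    orient b c d * linForm α β a - orient a c d * linForm α β b
      + orient a b d * linForm α β c - orient a b c * linForm α β d = 0 := by
  simp only [orient, linForm]; ring

lemma orient_sum (a b c d : ℝ × ℝ) :
    orient b c d - orient a c d + orient a b d - orient a b c = 0 := by
  simp only [orient]; ring

lemma dotAt_comm (q x y : ℝ × ℝ) : dotAt q x y = dotAt q y x := by
  simp only [dotAt]; ring

lemma dotAt_self_pos {q x : ℝ × ℝ} (h : x ≠ q) : 0 < dotAt q x x := by
  have h0 : x.1 - q.1 ≠ 0 ∨ x.2 - q.2 ≠ 0 := by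
    by_contra! hc
    exact h (Prod.ext (by linarith [hc.1]) (by linarith [hc.2]))
  simp only [dotAt]
  rcases h0 with h0 | h0
  · have := mul_self_pos.2 h0
    nlinarith [mul_self_nonneg (x.2 - q.2)]
  · have := mul_self_pos.2 h0
    nlinarith [mul_self_nonneg (x.1 - q.1)]

/-- On the line through `q` and `t`, the position along `t - q` can be read off from any linear
form. -/
lemma dotAt_mul_linForm (α β : ℝ) {q t x : ℝ × ℝ} (h : orient q t x = 0) :
    dotAt q x t * (linForm α β t - linForm α β q)
      = (linForm α β x - linForm α β q) * dotAt q t t := by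
  simp only [orient, linForm, dotAt] at *
  linear_combination (α * (t.2 - q.2) - β * (t.1 - q.1)) * h

/-- `t` is a point of `S` at which the tangent from `q` touches `S`: all points of `S` lie weakly
to the right (for `s = 1`) or to the left (for `s = -1`) of the line from `q` to `t`, and none of
them lies beyond `t` on the ray from `q` through `t`. -/
structure IsTangentPoint (s : ℝ) (S : Set (ℝ × ℝ)) (q t : ℝ × ℝ) : Prop where
  mem : t ∈ S
  ne : t ≠ q
  side : ∀ x ∈ S, s * orient q t x ≤ 0
  farthest : ∀ x ∈ S, orient q t x = 0 → dotAt q x t ≤ dotAt q t t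

lemma IsTangentPoint.mono {s : ℝ} {S T : Set (ℝ × ℝ)} {q t : ℝ × ℝ} (h : IsTangentPoint s T q t)
    (hST : S ⊆ T) (ht : t ∈ S) : IsTangentPoint s S q t :=
  ⟨ht, h.ne, fun x hx => h.side x (hST hx), fun x hx => h.farthest x (hST hx)⟩

/-- The criterion for binary search on a convex chain: a step from `u m` to `u (m + 1)` of the chain
precedes the tangent point from `q` if and only if it starts before the chain has passed `q`, or
the line through the step has `q` on its outer side.  The chain is strictly monotone with respect
to a linear form and turns strictly in one sense. -/
lemma chain_step_iff {α β s : ℝ} {u : ℕ → ℝ × ℝ} {L k : ℕ} {q : ℝ × ℝ}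
    (hF : ∀ a b, a < b → b ≤ L → linForm α β (u b) < linForm α β (u a))
    (hturn : ∀ a b c, a < b → b < c → c ≤ L → s * orient (u a) (u b) (u c) < 0)
    (hk0 : 0 < k) (hkL : k < L) (ht : IsTangentPoint s (u '' Set.Iic L) q (u k))
    (hq : linForm α β q = linForm α β (u k) → q = u k) {m : ℕ} (hm : m < L) :
    (linForm α β q ≤ linForm α β (u m) ∨ 0 ≤ s * orient (u m) (u (m + 1)) q) ↔ m < k := by
  have hs0 : s ≠ 0 := by
    rintro rfl
    simpa using hturn (k - 1) k (k + 1) (by omega) (by omega) (by omega)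
  have side : ∀ m ≤ L, s * orient q (u k) (u m) ≤ 0 := fun m hm => ht.side _ ⟨m, hm, rfl⟩
  -- the chain reaches its tangent point only after it has passed `q`
  have hqt : linForm α β (u k) < linForm α β q := by
    by_contra! hle
    have hlt : linForm α β q < linForm α β (u k) :=
      lt_of_le_of_ne hle fun h => ht.ne (hq h).symm
    have e1 := orient_linForm α β (u (k - 1)) (u k) (u (k + 1)) q
    have e2 := orient_sum (u (k - 1)) (u k) (u (k + 1)) q
    have h1 := side (k - 1) (by omega)
    have h2 := side (k + 1) (by omega)
    have h3 := hturn (k - 1) k (k + 1) (by omega) (by omega) (by omega)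
    have f1 := hF (k - 1) k (by omega) (by omega)
    have f2 := hF k (k + 1) (by omega) (by omega)
    have r1 : orient (u (k - 1)) (u k) q = - orient q (u k) (u (k - 1)) := by
      simp only [orient]; ring
    have r2 : orient (u k) (u (k + 1)) q = orient q (u k) (u (k + 1)) := by
      simp only [orient]; ring
    have g1 := mul_nonneg (neg_nonneg.2 h1) (sub_nonneg.2 f2.le)
    have g2 := mul_nonneg (neg_nonneg.2 h2) (sub_nonneg.2 f1.le)
    have g3 := mul_pos (neg_pos.2 h3) (sub_pos.2 hlt)
    rw [r1, r2] at e1 e2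
    have : (0:ℝ) < 0 := by
      linear_combination g1 + g2 + g3 - s * e1 + s * linForm α β (u k) * e2
    exact lt_irrefl _ this
  constructor
  · intro h
    by_contra! hkm
    have hmq : linForm α β (u m) < linForm α β q := by
      rcases hkm.eq_or_lt with rfl | hlt
      · exact hqt
      · exact (hF _ _ hlt hm.le).trans hqt
    have hE : 0 ≤ s * orient (u m) (u (m + 1)) q := h.resolve_left (not_le.2 hmq)
    rcases hkm.eq_or_lt with rfl | hlt
    · have h1 := side (k + 1) hm
      have r2 : orient (u k) (u (k + 1)) q = orient q (u k) (u (k + 1)) := by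
        simp only [orient]; ring
      rw [r2] at hE
      have h0 : orient q (u k) (u (k + 1)) = 0 :=
        (mul_eq_zero.1 (le_antisymm h1 hE)).resolve_left hs0
      have hfar := ht.farthest _ ⟨k + 1, hm, rfl⟩ h0
      have e := dotAt_mul_linForm α β h0
      have f2 := hF k (k + 1) (by omega) (by omega)
      have hp := dotAt_self_pos ht.ne
      have g1 := mul_nonneg (sub_nonneg.2 hfar) (sub_nonneg.2 hqt.le)
      have g2 := mul_pos hp (sub_pos.2 f2)
      have : (0:ℝ) < 0 := by linear_combination g1 + g2 + e
      exact lt_irrefl _ this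
    · have e1 := orient_linForm α β (u k) (u m) (u (m + 1)) q
      have e2 := orient_sum (u k) (u m) (u (m + 1)) q
      have h1 := side m hm.le
      have h3 := hturn k m (m + 1) hlt (by omega) hm
      have f1 := hF k m hlt hm.le
      have f2 := hF m (m + 1) (by omega) hm
      have r1 : orient (u k) (u m) q = orient q (u k) (u m) := by
        simp only [orient]; ring
      have g1 := mul_nonneg hE (sub_nonneg.2 f1.le)
      have g2 := mul_nonneg (neg_nonneg.2 h1) (sub_nonneg.2 f2.le)
      have g3 := mul_pos (neg_pos.2 h3) (sub_pos.2 hmq)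
      rw [r1] at e1 e2
      have : (0:ℝ) < 0 := by
        linear_combination g1 + g2 + g3 + s * e1 - s * linForm α β (u m) * e2
      exact lt_irrefl _ this
  · intro hmk
    by_contra! hcon
    obtain ⟨hmq, hE⟩ := hcon
    rcases (Nat.succ_le_of_lt hmk).eq_or_lt with heq | hlt
    · have h1 := side m hm.le
      have r1 : orient (u m) (u (m + 1)) q = - orient q (u k) (u m) := by
        rw [← heq]; simp only [orient]; ring
      rw [r1] at hE
      linarith
    · have hlt : m + 1 < k := hlt
      have e1 := orient_linForm α β (u m) (u (m + 1)) (u k) q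
      have e2 := orient_sum (u m) (u (m + 1)) (u k) q
      have h1 := side m hm.le
      have h2 := side (m + 1) hm
      have h3 := hturn m (m + 1) k (by omega) hlt hkL.le
      have f1 := hF m (m + 1) (by omega) hm
      have f2 := hF (m + 1) k hlt hkL.le
      have r1 : orient (u m) (u k) q = - orient q (u k) (u m) := by
        simp only [orient]; ring
      have r2 : orient (u (m + 1)) (u k) q = - orient q (u k) (u (m + 1)) := by
        simp only [orient]; ring
      have g1 := mul_nonneg (neg_nonneg.2 h2) (sub_nonneg.2 f1.le)
      have g2 := mul_pos (neg_pos.2 h3) (sub_pos.2 (f1.trans hmq))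
      have g3 := mul_pos (neg_pos.2 hE) (sub_pos.2 f2)
      rw [r1, r2] at e1 e2
      have : (0:ℝ) < 0 := by
        linear_combination g1 + g2 + g3 + s * e1 - s * linForm α β (u (m + 1)) * e2
      exact lt_irrefl _ this

/-- Four vertices in clockwise order: if a linear form is largest at the first one, then among the
other three it is not largest at the middle one. -/
lemma clockwise_chain {α β : ℝ} {w x y z : ℝ × ℝ} (hxyz : orient x y z < 0)
    (hwyz : orient w y z < 0) (hwxz : orient w x z < 0) (hwxy : orient w x y < 0) :
    (linForm α β x ≤ linForm α β w → linForm α β z < linForm α β x →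
      linForm α β y ≤ linForm α β w → linForm α β y < linForm α β x) ∧
    (linForm α β y ≤ linForm α β w → linForm α β x < linForm α β z →
      linForm α β y < linForm α β z) := by
  have e1 := orient_linForm α β w x y z
  have e2 := orient_sum w x y z
  constructor
  · intro h1 h2 h3
    by_contra! h
    have g1 := mul_nonneg (neg_pos.2 hxyz).le (sub_nonneg.2 h1)
    have g2 := mul_nonneg (neg_pos.2 hwxz).le (sub_nonneg.2 h)
    have g3 := mul_pos (neg_pos.2 hwxy) (sub_pos.2 h2)
    have : (0:ℝ) < 0 := by
      linear_combination g1 + g2 + g3 - e1 + linForm α β x * e2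
    exact lt_irrefl _ this
  · intro h1 h2
    by_contra! h
    have g1 := mul_nonneg (neg_pos.2 hxyz).le (sub_nonneg.2 (h.trans h1))
    have g2 := mul_nonneg (neg_pos.2 hwxz).le (sub_nonneg.2 h)
    have g3 := mul_pos (neg_pos.2 hwyz) (sub_pos.2 h2)
    have : (0:ℝ) < 0 := by
      linear_combination g1 + g2 + g3 - e1 + linForm α β z * e2
    exact lt_irrefl _ this

/-- A generic direction close to that of the first axis orders a finite set lexicographically. -/
lemma exists_linForm_lt_iff_lex (Z : Finset (ℝ × ℝ)) :
    ∃ ε : ℝ, ∀ x ∈ Z, ∀ y ∈ Z, linForm 1 ε x < linForm 1 ε y ↔ toLex x < toLex y := by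
  have key : ∀ x y : ℝ × ℝ, toLex x < toLex y →
      ∀ᶠ ε : ℝ in nhdsWithin 0 (Set.Ioi 0), linForm 1 ε x < linForm 1 ε y := by
    intro x y hxy
    rcases (Prod.Lex.toLex_lt_toLex.1 hxy) with h | ⟨h1, h2⟩
    · have hc : ∀ z : ℝ × ℝ, Filter.Tendsto (fun ε : ℝ => linForm 1 ε z)
          (nhdsWithin 0 (Set.Ioi 0)) (nhds (z.1)) := by
        intro z
        have : Continuous fun ε : ℝ => linForm 1 ε z := by unfold linForm; fun_prop
        have h := this.tendsto 0
        simp only [linForm, one_mul, zero_mul, add_zero] at h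
        exact (h.mono_left nhdsWithin_le_nhds).congr fun ε => by simp [linForm]
      exact (hc x).eventually_lt (hc y) h
    · filter_upwards [self_mem_nhdsWithin] with ε hε
      have := mul_lt_mul_of_pos_left h2 hε
      simp only [linForm]; linarith
  have hall : ∀ᶠ ε : ℝ in nhdsWithin 0 (Set.Ioi 0), ∀ x ∈ Z, ∀ y ∈ Z,
      toLex x < toLex y → linForm 1 ε x < linForm 1 ε y := by
    rw [Filter.eventually_all_finset]
    intro x _
    rw [Filter.eventually_all_finset]
    intro y _
    by_cases h : toLex x < toLex y
    · filter_upwards [key x y h] with ε hε _ using hε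
    · exact Filter.Eventually.of_forall fun ε h' => absurd h' h
  obtain ⟨ε, hε⟩ := hall.exists
  refine ⟨ε, fun x hx y hy => ⟨fun h => ?_, hε x hx y hy⟩⟩
  by_contra hn
  rcases (not_lt.1 hn).eq_or_lt with h' | h'
  · have : y = x := toLex.injective h'
    subst this; exact lt_irrefl _ h
  · exact lt_asymm h (hε y hy x hx h')

/-! ### The lexicographic order along a hull array -/

lemma mem_of_mem_hullVertices {S : Set (ℝ × ℝ)} {x : ℝ × ℝ} (h : x ∈ hullVertices S) : x ∈ S :=
  extremePoints_convexHull_subset h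

namespace IsHullArray

variable {S : Set (ℝ × ℝ)} {h l : ℕ} {v : ℕ → ℝ × ℝ}

lemma mem (H : IsHullArray S h l v) {k : ℕ} (hk : k < h) : v k ∈ S :=
  mem_of_mem_hullVertices (H.vertices ▸ ⟨k, hk, rfl⟩)

/-- From the lexicographic maximum to the minimum the array decreases. -/
lemma lex_lower (H : IsHullArray S h l v) {a b : ℕ} (hab : a < b) (hb : b ≤ l) :
    toLex (v b) < toLex (v a) := by
  have hl := H.min_index
  have hne : ∀ {a b : ℕ}, a < b → b < h → v a ≠ v b := fun hab hb e =>
    hab.ne (H.distinct (hab.trans hb) hb e)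
  obtain ⟨ε, hε⟩ := exists_linForm_lt_iff_lex {v 0, v a, v b, v l}
  have h0 : ∀ {c}, 0 < c → c < h → toLex (v c) < toLex (v 0) := fun {c} hc hc' =>
    lt_of_le_of_ne (H.first_max _ (H.mem hc')) fun e => hne hc hc' (toLex.injective e).symm
  have hmin : ∀ {c}, c < l → toLex (v l) < toLex (v c) := fun {c} hc =>
    lt_of_le_of_ne (H.min_min _ (H.mem (hc.trans hl))) fun e => hne hc hl (toLex.injective e).symm
  rcases Nat.eq_zero_or_pos a with rfl | ha
  · exact h0 hab (by omega)
  rcases hb.eq_or_lt with rfl | hbl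
  · exact hmin hab
  rw [← hε _ (by simp) _ (by simp)]
  refine (clockwise_chain (α := 1) (β := ε) (w := v 0) (z := v l)
    (H.clockwise a b l hab hbl hl) (H.clockwise 0 b l (by omega) hbl hl)
    (H.clockwise 0 a l ha (by omega) hl) (H.clockwise 0 a b ha hab (by omega))).1 ?_ ?_ ?_
  · exact ((hε _ (by simp) _ (by simp)).2 (h0 ha (by omega))).le
  · exact (hε _ (by simp) _ (by simp)).2 (hmin (by omega))
  · exact ((hε _ (by simp) _ (by simp)).2 (h0 (by omega) (by omega))).le

/-- From the lexicographic minimum to its end the array increases. -/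
lemma lex_upper (H : IsHullArray S h l v) {a b : ℕ} (hla : l ≤ a) (hab : a < b) (hb : b < h) :
    toLex (v a) < toLex (v b) := by
  have hl := H.min_index
  have hne : ∀ {a b : ℕ}, a ≠ b → a < h → b < h → v a ≠ v b := fun hab ha hb e =>
    hab (H.distinct ha hb e)
  obtain ⟨ε, hε⟩ := exists_linForm_lt_iff_lex {v 0, v a, v b, v l}
  have h0 : ∀ {c}, 0 < c → c < h → toLex (v c) < toLex (v 0) := fun {c} hc hc' =>
    lt_of_le_of_ne (H.first_max _ (H.mem hc')) fun e =>
      hne (by omega) (by omega) hc' (toLex.injective e).symm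
  have hmin : ∀ {c}, c ≠ l → c < h → toLex (v l) < toLex (v c) := fun {c} hc hch =>
    lt_of_le_of_ne (H.min_min _ (H.mem hch)) fun e => hne hc hch hl (toLex.injective e).symm
  rcases hla.eq_or_lt with rfl | hla
  · exact hmin (by omega) hb
  rcases Nat.eq_zero_or_pos l with rfl | hl0
  · exact absurd (hmin hla.ne' (by omega)) (lt_asymm (h0 hla (by omega)))
  rw [← hε _ (by simp) _ (by simp)]
  refine (clockwise_chain (α := 1) (β := ε) (w := v 0) (x := v l)
    (H.clockwise l a b hla hab hb) (H.clockwise 0 a b (by omega) hab hb)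
    (H.clockwise 0 l b hl0 (by omega) hb) (H.clockwise 0 l a hl0 hla (by omega))).2 ?_ ?_
  · exact ((hε _ (by simp) _ (by simp)).2 (h0 (by omega) (by omega))).le
  · exact (hε _ (by simp) _ (by simp)).2 (hmin (by omega) (by omega))

end IsHullArray

/-! ### Supporting lines and extreme points -/

/-- Through a boundary point of the convex hull of a finite set there is a supporting line. -/
lemma exists_supporting_line {S : Set (ℝ × ℝ)} (hS : S.Finite) {q : ℝ × ℝ}
    (hq : q ∈ frontier (convexHull ℝ S)) :
    ∃ n : ℝ × ℝ, n ≠ 0 ∧ ∀ x ∈ S, n.1 * (x.1 - q.1) + n.2 * (x.2 - q.2) ≤ 0 := by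
  obtain ⟨f, hf0, hf⟩ : ∃ f : (ℝ × ℝ) →ₗ[ℝ] ℝ, f ≠ 0 ∧ ∀ x ∈ S, f x ≤ f q := by
    by_cases hint : (interior (convexHull ℝ S)).Nonempty
    · obtain ⟨f, hf0, hf⟩ := geometric_hahn_banach_of_nonempty_interior_point
        (convex_convexHull ℝ S) hq.2 hint
      exact ⟨f, fun h => hf0 (ContinuousLinearMap.coe_injective h),
        fun x hx => hf x (subset_convexHull ℝ S hx)⟩
    · have hqc : q ∈ convexHull ℝ S := (hS.isClosed_convexHull ℝ).frontier_subset hq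
      have hqa : q ∈ affineSpan ℝ S := convexHull_subset_affineSpan S hqc
      rw [interior_convexHull_nonempty_iff_affineSpan_eq_top] at hint
      have hdir : (affineSpan ℝ S).direction ≠ ⊤ := fun h =>
        hint ((AffineSubspace.direction_eq_top_iff_of_nonempty ⟨q, hqa⟩).1 h)
      obtain ⟨f, hf0, hf⟩ := Submodule.exists_le_ker_of_lt_top _ (lt_top_iff_ne_top.2 hdir)
      refine ⟨f, hf0, fun x hx => ?_⟩
      have := hf (AffineSubspace.vsub_mem_direction (subset_affineSpan ℝ S hx) hqa)
      rw [LinearMap.mem_ker, vsub_eq_sub, map_sub] at this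
      linarith
  have hrep : ∀ x : ℝ × ℝ, f x = f (1, 0) * x.1 + f (0, 1) * x.2 := by
    intro x
    conv_lhs => rw [show x = x.1 • ((1 : ℝ), (0 : ℝ)) + x.2 • ((0 : ℝ), (1 : ℝ)) by ext <;> simp]
    rw [map_add, map_smul, map_smul, smul_eq_mul, smul_eq_mul]; ring
  refine ⟨(f (1, 0), f (0, 1)), fun h => hf0 (LinearMap.ext fun x => ?_), fun x hx => ?_⟩
  · rw [Prod.mk_eq_zero] at h
    rw [hrep, h.1, h.2]; simp
  · have := hf x hx
    rw [hrep x, hrep q] at this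
    linarith

lemma eq_of_dotAt_self_eq_zero {q x : ℝ × ℝ} (h : dotAt q x x = 0) : x = q := by
  by_contra hne
  exact (dotAt_self_pos hne).ne' h

/-- Lagrange's identity, for the part of `x - q` parallel to `t - q` and the part normal to it. -/
lemma dotAt_mul_dotAt (q t x : ℝ × ℝ) :
    dotAt t x x * dotAt q t t = orient q t x ^ 2 + (dotAt q x t - dotAt q t t) ^ 2 := by
  simp only [dotAt, orient]; ring

lemma orient_convex_combination (q t x y : ℝ × ℝ) (a : ℝ) :
    orient q t (a • x + (1 - a) • y) = a * orient q t x + (1 - a) * orient q t y := by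
  simp only [orient, Prod.fst_add, Prod.snd_add, Prod.smul_fst, Prod.smul_snd, smul_eq_mul]
  ring

lemma eq_zero_of_convex_combination {a b u v : ℝ} (ha : 0 < a) (hb : 0 < b) (hu : u ≤ 0)
    (hv : v ≤ 0) (h : a * u + b * v = 0) : u = 0 := by
  refine le_antisymm hu ?_
  by_contra! hlt
  have := mul_pos ha (neg_pos.2 hlt)
  have := mul_nonneg hb.le (neg_nonneg.2 hv)
  linarith

lemma IsTangentPoint.mem_hullVertices {s : ℝ} (hs : s ≠ 0) {S : Set (ℝ × ℝ)} (hS : S.Finite)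
    {q t : ℝ × ℝ} (h : IsTangentPoint s S q t) : t ∈ hullVertices S := by
  -- a linear form, steep in the direction normal to the tangent, whose maximum on `S` is at `t`
  obtain ⟨K, hK⟩ : ∃ K : ℝ, ∀ x ∈ S, dotAt q x t ≤ dotAt q t t + K * -(s * orient q t x) := by
    refine Filter.Eventually.exists (f := Filter.atTop) ?_
    rw [Filter.eventually_all_finite hS]
    intro x hx
    rcases (h.side x hx).eq_or_lt with h0 | h0
    · have := h.farthest x hx ((mul_eq_zero.1 h0).resolve_left hs)
      exact Filter.Eventually.of_forall fun K => by rw [h0]; linarith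
    · filter_upwards [Filter.eventually_ge_atTop
        ((dotAt q x t - dotAt q t t) / -(s * orient q t x))] with K hK
      rw [div_le_iff₀ (by linarith)] at hK
      linarith
  have hside : ∀ x ∈ convexHull ℝ S, s * orient q t x ≤ 0 := by
    intro x hx
    refine convexHull_min (t := {x | s * orient q t x ≤ 0}) h.side ?_ hx
    intro x hx y hy a b ha hb hab
    simp only [Set.mem_ofPred_eq] at *
    obtain rfl : b = 1 - a := by linarith
    rw [orient_convex_combination]
    nlinarith [mul_nonneg ha (neg_nonneg.2 hx), mul_nonneg hb (neg_nonneg.2 hy)]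
  have hKc : ∀ x ∈ convexHull ℝ S, dotAt q x t ≤ dotAt q t t + K * -(s * orient q t x) := by
    intro x hx
    refine convexHull_min (t := {x | dotAt q x t ≤ dotAt q t t + K * -(s * orient q t x)})
      hK ?_ hx
    intro x hx y hy a b ha hb hab
    simp only [Set.mem_ofPred_eq] at *
    obtain rfl : b = 1 - a := by linarith
    have e' : dotAt q (a • x + (1 - a) • y) t = a * dotAt q x t + (1 - a) * dotAt q y t := by
      simp only [dotAt, Prod.fst_add, Prod.snd_add, Prod.smul_fst, Prod.smul_snd, smul_eq_mul]
      ring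
    rw [orient_convex_combination, e']
    linarith [mul_le_mul_of_nonneg_left hx ha, mul_le_mul_of_nonneg_left hy hb]
  rw [hullVertices, mem_extremePoints_iff_left]
  refine ⟨subset_convexHull ℝ S h.mem, fun x hx y hy hxy => ?_⟩
  obtain ⟨a, b, ha, hb, hab, hst⟩ := hxy
  obtain rfl : b = 1 - a := by linarith
  have e : a * orient q t x + (1 - a) * orient q t y = 0 := by
    have : orient q t (a • x + (1 - a) • y) = 0 := by rw [hst]; simp only [orient]; ring
    rw [← this, orient_convex_combination]
  have e' : a * dotAt q x t + (1 - a) * dotAt q y t = dotAt q t t := by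
    conv_rhs => rw [← hst]
    conv_lhs => rw [← hst]
    simp only [dotAt, Prod.fst_add, Prod.snd_add, Prod.smul_fst, Prod.smul_snd, smul_eq_mul]
    ring
  have hx0 : s * orient q t x = 0 :=
    eq_zero_of_convex_combination ha hb (hside x hx) (hside y hy) (by linear_combination s * e)
  have hy0 : s * orient q t y = 0 :=
    eq_zero_of_convex_combination hb ha (hside y hy) (hside x hx) (by linear_combination s * e)
  have hx1 := hKc x hx
  have hy1 := hKc y hy
  rw [hx0] at hx1
  rw [hy0] at hy1
  have hd : dotAt q x t = dotAt q t t := sub_eq_zero.1 <|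
    eq_zero_of_convex_combination ha hb (u := dotAt q x t - dotAt q t t)
      (v := dotAt q y t - dotAt q t t) (by linarith) (by linarith) (by linear_combination e')
  have hid := dotAt_mul_dotAt q t x
  rw [hd, (mul_eq_zero.1 hx0).resolve_left hs] at hid
  refine eq_of_dotAt_self_eq_zero ?_
  have hp := dotAt_self_pos h.ne
  simpa [hp.ne'] using hid

/-! ### Comparing points by their direction from `q` -/

/-- Seen from `q`, the point `x` is a better candidate for the tangent point than `b`: it is on the
wrong side of the line from `q` to `b`, or beyond `b` on the ray from `q` through `b`.  Every point
other than `q` is better than `q`. -/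
def Improves (s : ℝ) (q b x : ℝ × ℝ) : Prop :=
  0 < s * orient q b x ∨
    0 ≤ s * orient q b x ∧ dotAt q b x < dotAt q x x ∧ 0 ≤ dotAt q b x

open Classical in
/-- The better one of the candidates `b` and `x`. -/
noncomputable def better (s : ℝ) (q b x : ℝ × ℝ) : ℝ × ℝ := if Improves s q b x then x else b

lemma improves_self {s : ℝ} {q x : ℝ × ℝ} (hx : x ≠ q) : Improves s q q x := by
  have h := dotAt_self_pos hx
  refine Or.inr ?_
  have h1 : orient q q x = 0 := by simp only [orient]; ring
  have h2 : dotAt q q x = 0 := by simp only [dotAt]; ring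
  rw [h1, h2]
  exact ⟨by simp, h, le_rfl⟩

lemma side_of_not_improves {s : ℝ} {q b x : ℝ × ℝ} (h : ¬ Improves s q b x) :
    s * orient q b x ≤ 0 := by
  by_contra! hc
  exact h (Or.inl hc)

lemma dotAt_le_of_not_improves {s : ℝ} {q b x : ℝ × ℝ} (h : ¬ Improves s q b x)
    (h0 : orient q b x = 0) : dotAt q x b ≤ dotAt q b b := by
  rw [dotAt_comm q x b]
  have hid : dotAt q b x ^ 2 = dotAt q b b * dotAt q x x := by
    have : dotAt q b x ^ 2 + orient q b x ^ 2 = dotAt q b b * dotAt q x x := by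
      simp only [dotAt, orient]; ring
    rw [← this, h0]; ring
  have hbb : 0 ≤ dotAt q b b := by
    simp only [dotAt]
    nlinarith [mul_self_nonneg (b.1 - q.1), mul_self_nonneg (b.2 - q.2)]
  by_contra! hlt
  refine h (Or.inr ⟨by rw [h0]; simp, ?_, by linarith⟩)
  by_contra! hc
  nlinarith

/-- The coordinate of `x` along the supporting line with outer normal `n` at `q`, increasing
towards the side on which tangent points for the sign `s` are sought. -/
def along (s : ℝ) (n q x : ℝ × ℝ) : ℝ := s * (n.2 * (x.1 - q.1) - n.1 * (x.2 - q.2))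

/-- The depth of `x` below the supporting line with outer normal `n` at `q`. -/
def depth (n q x : ℝ × ℝ) : ℝ := -(n.1 * (x.1 - q.1) + n.2 * (x.2 - q.2))

/-- `x` does not lie on the closed ray of the supporting line that starts at `q` and points away
from the sought tangent points.  On the other points of the half-plane the directions from `q` are
linearly ordered. -/
def Ahead (s : ℝ) (n q x : ℝ × ℝ) : Prop := 0 < depth n q x ∨ 0 < along s n q x

section HalfPlane

variable {s : ℝ} {n q b c x : ℝ × ℝ}

lemma improves_iff (hs : s * s = 1) (hn : n ≠ 0) : Improves s q b x ↔
    0 < depth n q b * along s n q x - along s n q b * depth n q x ∨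
    0 ≤ depth n q b * along s n q x - along s n q b * depth n q x ∧
      along s n q b * along s n q x + depth n q b * depth n q x <
        along s n q x * along s n q x + depth n q x * depth n q x ∧
      0 ≤ along s n q b * along s n q x + depth n q b * depth n q x := by
  have hN : 0 < dotAt 0 n n := dotAt_self_pos hn
  have h1 : depth n q b * along s n q x - along s n q b * depth n q x
      = dotAt 0 n n * (s * orient q b x) := by
    simp only [depth, along, dotAt, orient, Prod.fst_zero, Prod.snd_zero]; ring
  have h2 : ∀ y z, along s n q y * along s n q z + depth n q y * depth n q z
      = dotAt 0 n n * dotAt q y z := by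
    intro y z
    simp only [depth, along, dotAt, Prod.fst_zero, Prod.snd_zero]
    linear_combination (n.2 * (y.1 - q.1) - n.1 * (y.2 - q.2)) *
      (n.2 * (z.1 - q.1) - n.1 * (z.2 - q.2)) * hs
  rw [h1, h2, h2, mul_pos_iff_of_pos_left hN, mul_nonneg_iff_of_pos_left hN,
    mul_lt_mul_iff_right₀ hN, mul_nonneg_iff_of_pos_left hN, Improves]

lemma ahead_of_improves (hs : s * s = 1) (hn : n ≠ 0) (hb : 0 ≤ depth n q b)
    (hx : 0 ≤ depth n q x) (hab : Ahead s n q b) (h : Improves s q b x) : Ahead s n q x := by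
  rw [improves_iff hs hn] at h
  unfold Ahead at *
  by_contra! hc
  have hx0 : depth n q x = 0 := le_antisymm hc.1 hx
  rw [hx0] at h
  have h1 := mul_nonneg hb (neg_nonneg.2 hc.2)
  rcases h with h | ⟨h, h', h''⟩
  · linarith
  · rcases hc.2.eq_or_lt with h0 | h0
    · rw [h0] at h'; simp at h'
    · have hb0 : depth n q b = 0 := by
        rcases hb.eq_or_lt with h2 | h2
        · exact h2.symm
        · nlinarith [mul_pos h2 (neg_pos.2 h0)]
      have := hab.resolve_left (by rw [hb0]; exact lt_irrefl _)
      nlinarith [mul_pos this (neg_pos.2 h0)]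

/-- Parallel vectors of a half-plane, both ahead, have the same direction. -/
lemma dot_pos_of_parallel {X Y X' Y' : ℝ} (hY : 0 ≤ Y) (hY' : 0 ≤ Y') (h : 0 < Y ∨ 0 < X)
    (h' : 0 < Y' ∨ 0 < X') (hp : Y * X' - X * Y' = 0) : 0 < X * X' + Y * Y' := by
  rcases hY.eq_or_lt with rfl | hY0
  · have hX := h.resolve_left (lt_irrefl _)
    have hY0' : Y' = 0 := by
      have : X * Y' = 0 := by linarith
      exact (mul_eq_zero.1 this).resolve_left hX.ne'
    have := mul_pos hX (h'.resolve_left (by rw [hY0']; exact lt_irrefl _))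
    linarith
  · have hY0' : 0 < Y' := by
      refine lt_of_le_of_ne hY' fun h0 => ?_
      have := mul_pos hY0 (h'.resolve_left (by rw [← h0]; exact lt_irrefl _))
      rw [← h0] at hp
      linarith
    refine pos_of_mul_pos_right ?_ hY
    have : Y * (X * X' + Y * Y') = (X * X + Y * Y) * Y' := by linear_combination X * hp
    rw [this]
    have := mul_pos hY0 hY0
    have := mul_self_nonneg X
    positivity

/-- The order of directions in a half-plane is transitive. -/
lemma cross_trans {X Y Z W X' Y' : ℝ} (hY : 0 ≤ Y) (hW : 0 ≤ W) (hY' : 0 ≤ Y')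
    (h : 0 < Y ∨ 0 < X) (hZ : 0 < W ∨ 0 < Z) (h' : 0 < Y' ∨ 0 < X')
    (h₁ : 0 ≤ Y * Z - X * W) (h₂ : 0 ≤ W * X' - Z * Y') :
    0 ≤ Y * X' - X * Y' ∧
      (0 < Y * Z - X * W ∨ 0 < W * X' - Z * Y' → 0 < Y * X' - X * Y') := by
  rcases hW.eq_or_lt with rfl | hW0
  · have hZ0 := hZ.resolve_left (lt_irrefl _)
    have hY0' : Y' = 0 := by nlinarith [mul_nonneg hZ0.le hY']
    subst hY0'
    have hX' := h'.resolve_left (lt_irrefl _)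
    refine ⟨by nlinarith [mul_nonneg hY hX'.le], ?_⟩
    rintro (h3 | h3)
    · have hY0 : 0 < Y := by
        refine lt_of_le_of_ne hY fun h0 => ?_
        rw [← h0] at h3; linarith
      nlinarith [mul_pos hY0 hX']
    · linarith
  · have key : W * (Y * X' - X * Y') = Y' * (Y * Z - X * W) + Y * (W * X' - Z * Y') := by ring
    have g1 := mul_nonneg hY' h₁
    have g2 := mul_nonneg hY h₂
    refine ⟨nonneg_of_mul_nonneg_right (by linarith : 0 ≤ W * (Y * X' - X * Y')) hW0, ?_⟩
    intro h3
    refine pos_of_mul_pos_right (?_ : 0 < W * (Y * X' - X * Y')) hW0.le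
    rw [key]
    have hY0 : 0 < Y := by
      refine lt_of_le_of_ne hY fun h0 => ?_
      have := mul_pos (h.resolve_left (by rw [← h0]; exact lt_irrefl _)) hW0
      rw [← h0] at h₁
      linarith
    rcases h3 with h3 | h3
    · rcases hY'.eq_or_lt with rfl | hY0'
      · have := mul_pos hW0 (h'.resolve_left (lt_irrefl _))
        have := mul_pos hY0 this
        linarith
      · have := mul_pos hY0' h3
        linarith
    · have := mul_pos hY0 h3
      linarith

/-- Among points ahead, the relation is given by the angle, and by the distance for equal angles. -/
lemma improves_iff_of_ahead (hs : s * s = 1) (hn : n ≠ 0) (hb : 0 ≤ depth n q b)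
    (hx : 0 ≤ depth n q x) (hab : Ahead s n q b) (hax : Ahead s n q x) : Improves s q b x ↔
    0 < depth n q b * along s n q x - along s n q b * depth n q x ∨
    0 ≤ depth n q b * along s n q x - along s n q b * depth n q x ∧
      along s n q b * along s n q b + depth n q b * depth n q b <
        along s n q x * along s n q x + depth n q x * depth n q x := by
  rw [improves_iff hs hn]
  unfold Ahead at *
  generalize along s n q b = X at *
  generalize along s n q x = X' at *
  generalize depth n q b = Y at *
  generalize depth n q x = Y' at *
  by_cases hpos : 0 < Y * X' - X * Y'
  · simp only [hpos, true_or]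
  simp only [hpos, false_or]
  refine and_congr_right fun hc => ?_
  have h0 : Y * X' - X * Y' = 0 := le_antisymm (not_lt.1 hpos) hc
  have hd := dot_pos_of_parallel hb hx hab hax h0
  have hsq : (X * X' + Y * Y') * (X * X' + Y * Y') = (X * X + Y * Y) * (X' * X' + Y' * Y') := by
    linear_combination (-(Y * X' - X * Y')) * h0
  refine ⟨fun h => ?_, fun h => ⟨?_, hd.le⟩⟩
  · by_contra! hcon
    nlinarith [mul_pos hd (sub_pos.2 h.1)]
  · by_contra! hcon
    have := mul_self_nonneg X
    have := mul_self_nonneg Y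
    nlinarith

lemma improves_trans (hs : s * s = 1) (hn : n ≠ 0) (hb : 0 ≤ depth n q b) (hc : 0 ≤ depth n q c)
    (hx : 0 ≤ depth n q x) (hab : Ahead s n q b) (h₁ : Improves s q b c) (h₂ : Improves s q c x) :
    Improves s q b x := by
  have hac := ahead_of_improves hs hn hb hc hab h₁
  have hax := ahead_of_improves hs hn hc hx hac h₂
  rw [improves_iff_of_ahead hs hn hb hc hab hac] at h₁
  rw [improves_iff_of_ahead hs hn hc hx hac hax] at h₂
  rw [improves_iff_of_ahead hs hn hb hx hab hax]
  have h₁' := h₁.elim le_of_lt And.left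
  have h₂' := h₂.elim le_of_lt And.left
  obtain ⟨hle, hlt⟩ := cross_trans hb hc hx hab hac hax h₁' h₂'
  rcases h₁ with h₁ | h₁
  · exact Or.inl (hlt (Or.inl h₁))
  rcases h₂ with h₂ | h₂
  · exact Or.inl (hlt (Or.inr h₂))
  exact Or.inr ⟨hle, h₁.2.trans h₂.2⟩

lemma not_improves_self : ¬ Improves s q x x := by
  have h : orient q x x = 0 := by simp only [orient]; ring
  rintro (h' | h')
  · rw [h] at h'; simp at h'
  · exact lt_irrefl _ h'.2.1

/-- A point of the supporting line that is not ahead is improved by every deeper point. -/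
lemma depth_eq_zero_of_not_improves (hs : s * s = 1) (hn : n ≠ 0) (hb : 0 ≤ depth n q b)
    (hx : 0 ≤ depth n q x) (hab : ¬ Ahead s n q b) (h : ¬ Improves s q b x) :
    depth n q x = 0 := by
  rw [improves_iff hs hn] at h
  unfold Ahead at hab
  push Not at hab h
  have hb0 : depth n q b = 0 := le_antisymm hab.1 hb
  rw [hb0] at h
  by_contra hne
  have hx0 := lt_of_le_of_ne hx (Ne.symm hne)
  rcases hab.2.eq_or_lt with h0 | h0
  · rw [h0] at h
    have h1 := mul_pos hx0 hx0
    have h2 := mul_self_nonneg (along s n q x)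
    have := h.2 (by simp) (by simp only [zero_mul, add_zero]; linarith)
    simp at this
  · have := mul_pos (neg_pos.2 h0) hx0
    linarith [h.1]

/-- On the supporting line, points that are not ahead are compared by distance only. -/
lemma improves_trans_of_not_ahead (hs : s * s = 1) (hn : n ≠ 0) (hb : 0 ≤ depth n q b)
    (hc : 0 ≤ depth n q c) (hx : depth n q x = 0) (hab : ¬ Ahead s n q b) (hac : ¬ Ahead s n q c)
    (h₁ : Improves s q b c) (h₂ : Improves s q c x) : Improves s q b x := by
  rw [improves_iff hs hn] at *
  unfold Ahead at *
  push Not at hab hac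
  have hc0 : depth n q c = 0 := le_antisymm hac.1 hc
  rw [le_antisymm hab.1 hb, hc0] at h₁
  rw [hc0, hx] at h₂
  rw [le_antisymm hab.1 hb, hx]
  simp only [zero_mul, mul_zero, sub_self, lt_irrefl, false_or, le_refl, true_and, add_zero]
    at h₁ h₂ ⊢
  generalize along s n q b = X at *
  generalize along s n q c = Z at *
  generalize along s n q x = X' at *
  have hZ : Z < 0 := lt_of_le_of_ne hac.2 (by rintro rfl; simp at h₁)
  have hX' : X' ≤ 0 := by nlinarith [h₂.2]
  have hZX : Z < X := by nlinarith [h₁.1]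
  have hXZ : X' < Z := by nlinarith [h₂.1]
  exact ⟨by nlinarith, mul_nonneg_of_nonpos_of_nonpos hab.2 hX'⟩

lemma foldl_better_mem (s : ℝ) (q b : ℝ × ℝ) (L : List (ℝ × ℝ)) :
    L.foldl (better s q) b = b ∨ L.foldl (better s q) b ∈ L := by
  induction L using List.reverseRecOn with
  | nil => simp
  | append_singleton L c ih =>
    rw [List.foldl_append, List.foldl_cons, List.foldl_nil, better]
    split_ifs
    · simp
    · rcases ih with ih | ih
      · exact Or.inl ih
      · exact Or.inr (List.mem_append_left _ ih)

lemma foldl_better_of_not_improves {L : List (ℝ × ℝ)} (h : ∀ x ∈ L, ¬ Improves s q b x) :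
    L.foldl (better s q) b = b := by
  induction L with
  | nil => rfl
  | cons c L ih =>
    rw [List.foldl_cons, better, if_neg (h c (by simp))]
    exact ih fun x hx => h x (List.mem_cons_of_mem _ hx)

lemma depth_foldl_better {L : List (ℝ × ℝ)} (hL : ∀ x ∈ L, 0 ≤ depth n q x)
    (hb : 0 ≤ depth n q b) : 0 ≤ depth n q (L.foldl (better s q) b) := by
  rcases foldl_better_mem s q b L with h | h
  · rwa [h]
  · exact hL _ h

/-- A pass over a list of candidates ends with a point ahead, or meets only candidates on the
supporting line. -/
lemma foldl_better_from_behind (hs : s * s = 1) (hn : n ≠ 0) {L : List (ℝ × ℝ)}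
    (hL : ∀ x ∈ L, 0 ≤ depth n q x) (hb : 0 ≤ depth n q b) :
    Ahead s n q (L.foldl (better s q) b) ∨
      ∀ x ∈ L, depth n q x = 0 ∧ ¬ Improves s q (L.foldl (better s q) b) x := by
  induction L using List.reverseRecOn with
  | nil => simp
  | append_singleton L c ih =>
    have hL' : ∀ x ∈ L, 0 ≤ depth n q x := fun x hx => hL x (List.mem_append_left _ hx)
    have hc : 0 ≤ depth n q c := hL c (by simp)
    have hB := depth_foldl_better (s := s) hL' hb
    rw [List.foldl_append, List.foldl_cons, List.foldl_nil]
    generalize L.foldl (better s q) b = B at *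
    specialize ih hL'
    rw [better]
    split_ifs with himp
    · by_cases hac : Ahead s n q c
      · exact Or.inl hac
      have haB : ¬ Ahead s n q B := fun haB => hac (ahead_of_improves hs hn hB hc haB himp)
      refine Or.inr fun x hx => ?_
      rcases List.mem_append.1 hx with hx | hx
      · obtain ⟨hx0, hxi⟩ := ih.resolve_left haB x hx
        exact ⟨hx0, fun h => hxi (improves_trans_of_not_ahead hs hn hB hc hx0 haB hac himp h)⟩
      · rw [List.mem_singleton.1 hx]
        exact ⟨le_antisymm (not_lt.1 fun h => hac (Or.inl h)) hc, not_improves_self⟩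
    · refine or_iff_not_imp_left.2 fun haB x hx => ?_
      rcases List.mem_append.1 hx with hx | hx
      · exact ih.resolve_left haB x hx
      · rw [List.mem_singleton.1 hx]
        exact ⟨depth_eq_zero_of_not_improves hs hn hB hc haB himp, himp⟩

/-- A pass that starts with a point ahead finds the best candidate. -/
lemma foldl_better_of_ahead (hs : s * s = 1) (hn : n ≠ 0) {L : List (ℝ × ℝ)}
    (hL : ∀ x ∈ L, 0 ≤ depth n q x) (hb : 0 ≤ depth n q b) (hab : Ahead s n q b) :
    Ahead s n q (L.foldl (better s q) b) ∧
      ∀ x ∈ L, ¬ Improves s q (L.foldl (better s q) b) x := by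
  induction L using List.reverseRecOn with
  | nil => simpa using hab
  | append_singleton L c ih =>
    have hL' : ∀ x ∈ L, 0 ≤ depth n q x := fun x hx => hL x (List.mem_append_left _ hx)
    have hc : 0 ≤ depth n q c := hL c (by simp)
    have hB := depth_foldl_better (s := s) hL' hb
    rw [List.foldl_append, List.foldl_cons, List.foldl_nil]
    generalize L.foldl (better s q) b = B at *
    obtain ⟨haB, ih⟩ := ih hL'
    rw [better]
    split_ifs with himp
    · refine ⟨ahead_of_improves hs hn hB hc haB himp, fun x hx h => ?_⟩
      rcases List.mem_append.1 hx with hx | hx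
      · exact ih x hx (improves_trans hs hn hB hc (hL' x hx) haB himp h)
      · rw [List.mem_singleton.1 hx] at h
        exact not_improves_self h
    · refine ⟨haB, fun x hx => ?_⟩
      rcases List.mem_append.1 hx with hx | hx
      · exact ih x hx
      · rwa [List.mem_singleton.1 hx]

/-- Two passes over the candidates end with one that no candidate improves.  One pass may be
misled by a first candidate opposite to the best one, as opposite points do not improve each
other; the second pass then starts from a point ahead, or there are no points off the supporting
line. -/
lemma foldl_better_append_self (hs : s * s = 1) (hn : n ≠ 0) {L : List (ℝ × ℝ)}
    (hL : ∀ x ∈ L, n.1 * (x.1 - q.1) + n.2 * (x.2 - q.2) ≤ 0) :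
    ∀ x ∈ L, ¬ Improves s q ((L ++ L).foldl (better s q) q) x := by
  have hL' : ∀ x ∈ L, 0 ≤ depth n q x := fun x hx => neg_nonneg.2 (hL x hx)
  have hq : 0 ≤ depth n q q := by simp [depth]
  rw [List.foldl_append]
  by_cases h : Ahead s n q (L.foldl (better s q) q)
  · exact (foldl_better_of_ahead hs hn hL' (depth_foldl_better hL' hq) h).2
  · have := (foldl_better_from_behind hs hn hL' hq).resolve_left h
    rw [foldl_better_of_not_improves fun x hx => (this x hx).2]
    exact fun x hx => (this x hx).2

end HalfPlane

/-! ### Tangent points -/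

lemma isTangentPoint_of_not_improves {s : ℝ} {S : Set (ℝ × ℝ)} {q b : ℝ × ℝ} (hb : b ∈ S)
    (hbq : b ≠ q) (h : ∀ x ∈ S, ¬ Improves s q b x) : IsTangentPoint s S q b :=
  ⟨hb, hbq, fun x hx => side_of_not_improves (h x hx),
    fun x hx h0 => dotAt_le_of_not_improves (h x hx) h0⟩

/-- The result of two passes is a candidate other than `q`, if there is one. -/
lemma foldl_better_append_self_mem {s : ℝ} (hs : s * s = 1) {n q : ℝ × ℝ} (hn : n ≠ 0)
    {L : List (ℝ × ℝ)} (hL : ∀ x ∈ L, n.1 * (x.1 - q.1) + n.2 * (x.2 - q.2) ≤ 0)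
    (hne : ∃ x ∈ L, x ≠ q) :
    (L ++ L).foldl (better s q) q ∈ L ∧ (L ++ L).foldl (better s q) q ≠ q := by
  have h := foldl_better_append_self hs hn hL
  obtain ⟨x, hx, hxq⟩ := hne
  have hq : (L ++ L).foldl (better s q) q ≠ q := fun e => by
    have := h x hx
    rw [e] at this
    exact this (improves_self hxq)
  refine ⟨?_, hq⟩
  simpa using (foldl_better_mem s q q (L ++ L)).resolve_left hq

lemma exists_isTangentPoint {s : ℝ} (hs : s * s = 1) {S : Set (ℝ × ℝ)} (hS : S.Finite)
    {q : ℝ × ℝ} (hq : q ∈ frontier (convexHull ℝ S)) (hne : ∃ x ∈ S, x ≠ q) :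
    ∃ t, IsTangentPoint s S q t := by
  obtain ⟨n, hn, hL⟩ := exists_supporting_line hS hq
  have hmem : ∀ x, x ∈ hS.toFinset.toList ↔ x ∈ S := by simp
  have hL' : ∀ x ∈ hS.toFinset.toList, n.1 * (x.1 - q.1) + n.2 * (x.2 - q.2) ≤ 0 :=
    fun x hx => hL x ((hmem x).1 hx)
  obtain ⟨hm, hq⟩ := foldl_better_append_self_mem hs hn hL'
    (hne.imp fun x hx => ⟨(hmem x).2 hx.1, hx.2⟩)
  exact ⟨_, isTangentPoint_of_not_improves ((hmem _).1 hm) hq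
    fun x hx => foldl_better_append_self hs hn hL' x ((hmem x).2 hx)⟩

/-- Two passes over a list of candidates find a tangent point of `S` if the list contains all
tangent points of `S`, and is not contained in a line through `q` unless `S` is. -/
lemma isTangentPoint_foldl_better {s : ℝ} (hs : s * s = 1) {S : Set (ℝ × ℝ)} (hS : S.Finite)
    {q : ℝ × ℝ} (hq : q ∈ frontier (convexHull ℝ S)) (hne : ∃ x ∈ S, x ≠ q)
    {L : List (ℝ × ℝ)} (hLS : ∀ x ∈ L, x ∈ S) (htan : ∀ t, IsTangentPoint s S q t → t ∈ L)
    (hline : ∀ t, t ≠ q → (∀ x ∈ L, orient q t x = 0) → ∀ x ∈ S, orient q t x = 0) :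
    IsTangentPoint s S q ((L ++ L).foldl (better s q) q) := by
  have hs0 : s ≠ 0 := by rintro rfl; simp at hs
  obtain ⟨t, ht⟩ := exists_isTangentPoint hs hS hq hne
  obtain ⟨n, hn, hL⟩ := exists_supporting_line hS hq
  have hL' : ∀ x ∈ L, n.1 * (x.1 - q.1) + n.2 * (x.2 - q.2) ≤ 0 := fun x hx => hL x (hLS x hx)
  have himp := foldl_better_append_self hs hn hL'
  obtain ⟨hbL, hbq⟩ := foldl_better_append_self_mem hs hn hL' ⟨t, htan t ht, ht.ne⟩
  generalize (L ++ L).foldl (better s q) q = b at *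
  have hbS := hLS b hbL
  have hbb := dotAt_self_pos hbq
  have htt := dotAt_self_pos ht.ne
  have hpar : orient q t b = 0 := by
    have h1 := side_of_not_improves (himp t (htan t ht))
    have h2 := ht.side b hbS
    have h3 : orient q b t = - orient q t b := by simp only [orient]; ring
    rw [h3] at h1
    exact (mul_eq_zero.1 (by linarith : s * orient q t b = 0)).resolve_left hs0
  have hpar' : orient q b t = 0 := by
    rw [← neg_eq_zero, ← hpar]; simp only [orient]; ring
  have hsq : dotAt q b t * dotAt q b t = dotAt q b b * dotAt q t t := by
    have : dotAt q b t * dotAt q b t + orient q t b ^ 2 = dotAt q b b * dotAt q t t := by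
      simp only [dotAt, orient]; ring
    rw [← this, hpar]; ring
  rcases lt_or_ge 0 (dotAt q b t) with hpos | hneg
  · -- `b` and `t` lie on the same ray, at the same distance
    have h1 := dotAt_le_of_not_improves (himp t (htan t ht)) hpar'
    rw [dotAt_comm q t b] at h1
    have h2 := ht.farthest b hbS hpar
    have h3 : dotAt q b t = dotAt q t t := by
      refine le_antisymm h2 ?_
      by_contra! hlt
      nlinarith [mul_pos hpos (sub_pos.2 hlt)]
    have hid := dotAt_mul_dotAt q t b
    rw [h3, hpar] at hid
    have : b = t := eq_of_dotAt_self_eq_zero (by simpa [htt.ne'] using hid)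
    rwa [this]
  · -- `b` and `t` are opposite, so that all points lie on one line
    have hlt : dotAt q b t < 0 := by
      refine lt_of_le_of_ne hneg fun h0 => ?_
      rw [h0] at hsq
      have := mul_pos hbb htt
      linarith
    have hid : ∀ x, orient q b x * dotAt q t t = dotAt q b t * orient q t x := by
      intro x
      have : orient q b x * dotAt q t t
          = dotAt q b t * orient q t x - orient q t b * dotAt q t x := by
        simp only [dotAt, orient]; ring
      rw [this, hpar]; ring
    have hcol : ∀ x ∈ S, orient q t x = 0 := by
      refine hline t ht.ne fun x hx => ?_
      have h1 := side_of_not_improves (himp x hx)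
      have h2 := ht.side x (hLS x hx)
      have h3 : s * orient q b x * dotAt q t t = dotAt q b t * (s * orient q t x) := by
        linear_combination s * hid x
      have h4 := mul_nonneg (neg_nonneg.2 h1) htt.le
      have h5 := mul_nonneg (neg_nonneg.2 hneg) (neg_nonneg.2 h2)
      have h6 : dotAt q b t * (s * orient q t x) = 0 := by linarith
      exact (mul_eq_zero.1 ((mul_eq_zero.1 h6).resolve_left hlt.ne)).resolve_left hs0
    have hcolb : ∀ x ∈ S, orient q b x = 0 := by
      intro x hx
      have := hid x
      rw [hcol x hx, mul_zero] at this
      exact (mul_eq_zero.1 this).resolve_right htt.ne'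
    obtain ⟨r, hr, hmax⟩ := hS.exists_maximalFor (fun x => dotAt q x b) S ⟨b, hbS⟩
    have hmax' : ∀ x ∈ S, dotAt q x b ≤ dotAt q r b := fun x hx => by
      by_contra! hlt
      exact absurd (hmax hx hlt.le) (not_le.2 hlt)
    have hrb : 0 < dotAt q r b := hbb.trans_le (hmax' b hbS)
    have hrq : r ≠ q := by
      rintro rfl
      simp [dotAt] at hrb
    have hdot : ∀ x, dotAt q x r * dotAt q b b = dotAt q x b * dotAt q r b := by
      intro x
      have : dotAt q x r * dotAt q b b
          = dotAt q x b * dotAt q r b + orient q b x * orient q b r := by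
        simp only [dotAt, orient]; ring
      rw [this, hcolb r hr]; ring
    have htr : IsTangentPoint s S q r := by
      refine ⟨hr, hrq, fun x hx => ?_, fun x hx _ => ?_⟩
      · have h1 : orient q r x * dotAt q b b
            = dotAt q r b * orient q b x - orient q b r * dotAt q b x := by
          simp only [dotAt, orient]; ring
        rw [hcolb x hx, hcolb r hr] at h1
        have : orient q r x = 0 := by simpa [hbb.ne'] using h1
        rw [this]; simp
      · refine le_of_mul_le_mul_right ?_ hbb
        rw [hdot, hdot]
        exact mul_le_mul_of_nonneg_right (hmax' x hx) hrb.le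
    have h1 := dotAt_le_of_not_improves (himp r (htan r htr)) (hcolb r hr)
    have h2 : dotAt q r b = dotAt q b b := le_antisymm h1 (hmax' b hbS)
    have h3 := dotAt_mul_dotAt q b r
    rw [h2, hcolb r hr] at h3
    have : r = b := eq_of_dotAt_self_eq_zero (by simpa [hbb.ne'] using h3)
    rwa [← this]

/-- The sign of the signed areas to the left of a tangent line, for each sense of rotation. -/
def Direction.sign : Direction → ℤ
  | .clockwise => 1
  | .counterclockwise => -1

lemma Direction.sign_mul_self (d : Direction) : ((d.sign : ℤ) : ℝ) * (d.sign : ℝ) = 1 := by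
  cases d <;> simp [Direction.sign]

lemma IsTangentPoint.isHullNeighbor {d : Direction} {S : Set (ℝ × ℝ)} (hS : S.Finite)
    {q t : ℝ × ℝ} (h : IsTangentPoint d.sign S q t) : IsHullNeighbor d S q t := by
  have hv := h.mem_hullVertices (by cases d <;> simp [Direction.sign]) hS
  have hside := h.side
  cases d
  · exact ⟨hv, h.ne, fun x hx => by simpa [Direction.sign] using hside x hx⟩
  · exact ⟨hv, h.ne, fun x hx => by simpa [Direction.sign] using hside x hx⟩

/-! ### Convex chains of a hull array -/

/-- The lexicographic order of the plane (for `τ = 1`) or its dual (for `τ = -1`). -/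
def LexLe (τ : ℝ) (a b : ℝ × ℝ) : Prop :=
  τ * a.1 ≤ τ * b.1 ∧ ¬ (τ * b.1 ≤ τ * a.1 ∧ ¬ τ * a.2 ≤ τ * b.2)

lemma lexLe_one {a b : ℝ × ℝ} : LexLe 1 a b ↔ toLex a ≤ toLex b := by
  rw [Prod.Lex.toLex_le_toLex, LexLe]
  simp only [one_mul]
  constructor
  · rintro ⟨h1, h2⟩
    rcases h1.lt_or_eq with h | h
    · exact Or.inl h
    · exact Or.inr ⟨h, not_not.1 fun h' => h2 ⟨h.ge, h'⟩⟩
  · rintro (h | ⟨h1, h2⟩)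
    · exact ⟨h.le, fun h' => absurd h'.1 (not_le.2 h)⟩
    · exact ⟨h1.le, fun h' => h'.2 h2⟩

lemma lexLe_neg_one {a b : ℝ × ℝ} : LexLe (-1) a b ↔ toLex b ≤ toLex a := by
  rw [← lexLe_one]
  simp only [LexLe, neg_mul, one_mul, neg_le_neg_iff]

lemma exists_linForm_le_iff_lexLe {τ : ℝ} (hτ : τ = 1 ∨ τ = -1) (Z : Finset (ℝ × ℝ)) :
    ∃ α β : ℝ, ∀ x ∈ Z, ∀ y ∈ Z, linForm α β x ≤ linForm α β y ↔ LexLe τ x y := by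
  obtain ⟨ε, hε⟩ := exists_linForm_lt_iff_lex Z
  rcases hτ with rfl | rfl
  · refine ⟨1, ε, fun x hx y hy => ?_⟩
    rw [lexLe_one, ← not_lt, ← not_lt, hε y hy x hx]
  · refine ⟨-1, -ε, fun x hx y hy => ?_⟩
    have hneg : ∀ z, linForm (-1) (-ε) z = - linForm 1 ε z := fun z => by
      simp only [linForm]; ring
    rw [lexLe_neg_one, hneg, hneg, neg_le_neg_iff, ← not_lt, ← not_lt, hε x hx y hy]

/-- The points `u 0, …, u L` decrease in the order `LexLe τ` and turn strictly to the right (for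
`s = 1`) or to the left (for `s = -1`). -/
structure IsConvexChain (τ s : ℝ) (u : ℕ → ℝ × ℝ) (L : ℕ) : Prop where
  anti : ∀ a b, a < b → b ≤ L → ¬ LexLe τ (u a) (u b)
  turn : ∀ a b c, a < b → b < c → c ≤ L → s * orient (u a) (u b) (u c) < 0

/-- The test for the binary search on a chain: the search goes on beyond `u m`. -/
def GoesOn (τ s : ℝ) (q : ℝ × ℝ) (u : ℕ → ℝ × ℝ) (m : ℕ) : Prop :=
  LexLe τ q (u m) ∨ 0 ≤ s * orient (u m) (u (m + 1)) q

lemma IsConvexChain.goesOn_iff {τ s : ℝ} (hτ : τ = 1 ∨ τ = -1) {u : ℕ → ℝ × ℝ} {L k : ℕ}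
    {q : ℝ × ℝ} (hu : IsConvexChain τ s u L) (hk0 : 0 < k) (hkL : k < L)
    (ht : IsTangentPoint s (u '' Set.Iic L) q (u k)) {m : ℕ} (hm : m < L) :
    GoesOn τ s q u m ↔ m < k := by
  obtain ⟨α, β, hF⟩ := exists_linForm_le_iff_lexLe hτ
    (insert q ((Finset.range (L + 1)).image u))
  have hmem : ∀ a, a ≤ L → u a ∈ insert q ((Finset.range (L + 1)).image u) := fun a ha =>
    Finset.mem_insert_of_mem (Finset.mem_image_of_mem u (Finset.mem_range.2 (by omega)))
  have hqm : q ∈ insert q ((Finset.range (L + 1)).image u) := Finset.mem_insert_self _ _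
  rw [← chain_step_iff (α := α) (β := β) (fun a b hab hb => ?_) hu.turn hk0 hkL ht ?_ hm, GoesOn,
    hF q hqm _ (hmem m hm.le)]
  · intro h
    have h1 := (hF q hqm _ (hmem k hkL.le)).1 h.le
    have h2 := (hF _ (hmem k hkL.le) q hqm).1 h.ge
    rcases hτ with rfl | rfl
    · rw [lexLe_one] at h1 h2
      exact toLex.injective (le_antisymm h1 h2)
    · rw [lexLe_neg_one] at h1 h2
      exact toLex.injective (le_antisymm h2 h1)
  · rw [← not_le, hF _ (hmem a (by omega)) _ (hmem b hb)]
    exact hu.anti a b hab hb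

namespace IsHullArray

variable {S : Set (ℝ × ℝ)} {h l : ℕ} {v : ℕ → ℝ × ℝ}

lemma pos (H : IsHullArray S h l v) : 0 < h := (Nat.zero_le l).trans_lt H.min_index

lemma chain_lower (H : IsHullArray S h l v) : IsConvexChain 1 1 v l where
  anti a b hab hb := by rw [lexLe_one, not_le]; exact H.lex_lower hab hb
  turn a b c hab hbc hc := by
    rw [one_mul]; exact H.clockwise a b c hab hbc (hc.trans_lt H.min_index)

lemma chain_upper (H : IsHullArray S h l v) :
    IsConvexChain (-1) 1 (fun m => v (l + m)) (h - 1 - l) where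
  anti a b hab hb := by
    have := H.min_index
    rw [lexLe_neg_one, not_le]; exact H.lex_upper (by omega) (by omega) (by omega)
  turn a b c hab hbc hc := by
    have := H.min_index
    rw [one_mul]; exact H.clockwise _ _ _ (by omega) (by omega) (by omega)

lemma chain_lower_reverse (H : IsHullArray S h l v) :
    IsConvexChain (-1) (-1) (fun m => v (l - m)) l where
  anti a b hab hb := by
    rw [lexLe_neg_one, not_le]; exact H.lex_lower (by omega) (by omega)
  turn a b c hab hbc hc := by
    have := H.min_index
    have := H.clockwise (l - c) (l - b) (l - a) (by omega) (by omega) (by omega)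
    simp only [orient] at *
    linarith

lemma chain_upper_reverse (H : IsHullArray S h l v) :
    IsConvexChain 1 (-1) (fun m => v (h - 1 - m)) (h - 1 - l) where
  anti a b hab hb := by
    have := H.min_index
    rw [lexLe_one, not_le]; exact H.lex_upper (by omega) (by omega) (by omega)
  turn a b c hab hbc hc := by
    have := H.min_index
    have := H.clockwise (h - 1 - c) (h - 1 - b) (h - 1 - a) (by omega) (by omega) (by omega)
    simp only [orient] at *
    linarith

/-- The first, the middle and the last vertex lie on a line only if all points do. -/
lemma collinear (H : IsHullArray S h l v) (hS : S.Finite) {q t : ℝ × ℝ} (htq : t ≠ q)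
    (h0 : orient q t (v 0) = 0) (h1 : orient q t (v (h / 2)) = 0)
    (h2 : orient q t (v (h - 1)) = 0) : ∀ x ∈ S, orient q t x = 0 := by
  have hpos := H.pos
  have hh : h ≤ 2 := by
    by_contra! hh
    have hneg := H.clockwise 0 (h / 2) (h - 1) (by omega) (by omega) (by omega)
    have hid : orient (v 0) (v (h / 2)) (v (h - 1)) * dotAt q t t = 0 := by
      simp only [orient, dotAt] at *
      generalize v 0 = a at *
      generalize v (h / 2) = b at *
      generalize v (h - 1) = c at *
      linear_combination
        ((b.1 - a.1) * (t.1 - q.1) + (b.2 - a.2) * (t.2 - q.2)) * (h2 - h0)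
          - ((c.1 - a.1) * (t.1 - q.1) + (c.2 - a.2) * (t.2 - q.2)) * (h1 - h0)
    exact absurd ((mul_eq_zero.1 hid).resolve_right (dotAt_self_pos htq).ne') hneg.ne
  have hv : hullVertices S ⊆ {x | orient q t x = 0} := by
    rw [← H.vertices]
    rintro _ ⟨k, hk, rfl⟩
    have hk : k < h := hk
    have : k = 0 ∨ k = h - 1 := by omega
    rcases this with rfl | rfl
    · exact h0
    · exact h2
  have hconv : Convex ℝ {x | orient q t x = 0} := by
    intro x hx y hy a b ha hb hab
    simp only [Set.mem_ofPred_eq] at *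
    obtain rfl : b = 1 - a := by linarith
    rw [orient_convex_combination, hx, hy]; simp
  have hclosed : IsClosed {x | orient q t x = 0} := by
    refine isClosed_eq ?_ continuous_const
    unfold orient; fun_prop
  intro x hx
  have hx' := subset_convexHull ℝ S hx
  rw [← closure_convexHull_extremePoints (hS.isCompact_convexHull ℝ) (convex_convexHull ℝ S)] at hx'
  exact closure_minimal (convexHull_min hv hconv) hclosed hx'

lemma le_card (H : IsHullArray S h l v) {F : Finset (ℝ × ℝ)} (hF : S ⊆ F) : h ≤ F.card := by
  rw [← Finset.card_range h]
  refine Finset.card_le_card_of_injOn v (fun k hk => hF (H.mem (Finset.mem_range.1 hk))) ?_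
  intro a ha b hb
  exact H.distinct (by simpa using ha) (by simpa using hb)

end IsHullArray

/-! ### Programs that offer candidates -/

/-- The point whose coordinates are in the real registers `x` and `x + 1`. -/
def State.point (σ : State) (x : ℕ) : ℝ × ℝ := (σ.real x, σ.real (x + 1))

/-- Started with integer registers satisfying `Pre` and with the query point `q` in the real
registers `2` and `3`, the program halts within `T` steps with integer registers satisfying `Post`,
the query point unchanged, and the candidate in the real registers `0` and `1` replaced by the best
one of itself and the points of `L`, offered one after the other. -/
def Offers (M : Memory) (s : ℝ) (q : ℝ × ℝ) (P : Prog) (T : ℕ) (Pre Post : (ℕ → ℤ) → Prop)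
    (L : List (ℝ × ℝ)) : Prop :=
  ∀ σ : State, Pre σ.int → σ.point 2 = q → ∃ (t : ℕ) (σ' : State), Run M P σ t σ' ∧ t ≤ T ∧
    Post σ'.int ∧ σ'.point 2 = q ∧ σ'.point 0 = L.foldl (better s q) (σ.point 0)

section Rules

variable {M : Memory} {s : ℝ} {q : ℝ × ℝ} {P Q : Prog} {T T₁ T₂ : ℕ}
  {Pre Mid Post : (ℕ → ℤ) → Prop} {L L₁ L₂ : List (ℝ × ℝ)}

lemma Offers.mono {Pre' Post' : (ℕ → ℤ) → Prop} {T' : ℕ} (h : Offers M s q P T Pre Post L)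
    (hpre : ∀ ρ, Pre' ρ → Pre ρ) (hpost : ∀ ρ, Post ρ → Post' ρ) (hT : T ≤ T') :
    Offers M s q P T' Pre' Post' L := by
  intro σ hσ hq
  obtain ⟨t, σ', hrun, ht, hpo, h⟩ := h σ (hpre _ hσ) hq
  exact ⟨t, σ', hrun, ht.trans hT, hpost _ hpo, h⟩

lemma Offers.seq (h₁ : Offers M s q P T₁ Pre Mid L₁) (h₂ : Offers M s q Q T₂ Mid Post L₂) :
    Offers M s q (.seq P Q) (T₁ + T₂) Pre Post (L₁ ++ L₂) := by
  intro σ hσ hq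
  obtain ⟨t₁, σ₁, hrun₁, ht₁, hpo₁, hq₁, hb₁⟩ := h₁ σ hσ hq
  obtain ⟨t₂, σ₂, hrun₂, ht₂, hpo₂, hq₂, hb₂⟩ := h₂ σ₁ hpo₁ hq₁
  exact ⟨_, _, .seq hrun₁ hrun₂, by omega, hpo₂, hq₂, by rw [hb₂, hb₁, List.foldl_append]⟩

lemma Offers.skip (h : ∀ ρ, Pre ρ → Post ρ) : Offers M s q .skip 1 Pre Post [] :=
  fun σ hσ hq => ⟨_, _, .skip σ, le_rfl, h _ hσ, hq, rfl⟩

lemma Offers.setInt {x : ℕ} {e : IExpr}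
    (h : ∀ σ : State, Pre σ.int → Post (Function.update σ.int x (e.eval M σ))) :
    Offers M s q (.setInt x e) (e.cost + 1) Pre Post [] :=
  fun σ hσ hq => ⟨_, _, .setInt x e σ, le_rfl, h _ hσ, hq, rfl⟩

lemma Offers.ite {b : Test} (β : Prop)
    (hb : ∀ σ : State, Pre σ.int → σ.point 2 = q → (b.holds M σ ↔ β))
    (hP : β → Offers M s q P T Pre Post L) (hQ : ¬ β → Offers M s q Q T Pre Post L) :
    Offers M s q (.ite b P Q) (b.cost + 1 + T) Pre Post L := by
  intro σ hσ hq
  by_cases hβ : β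
  · obtain ⟨t, σ', hrun, ht, h⟩ := hP hβ σ hσ hq
    exact ⟨_, _, .iteTrue ((hb σ hσ hq).2 hβ) hrun, by omega, h⟩
  · obtain ⟨t, σ', hrun, ht, h⟩ := hQ hβ σ hσ hq
    exact ⟨_, _, .iteFalse (fun hc => hβ ((hb σ hσ hq).1 hc)) hrun, by omega, h⟩

lemma Offers.loop_done {b : Test} (hb : ∀ σ : State, Pre σ.int → ¬ b.holds M σ)
    (h : ∀ ρ, Pre ρ → Post ρ) : Offers M s q (.loop b P) (b.cost + 1) Pre Post [] :=
  fun σ hσ hq => ⟨_, _, .loopDone (hb σ hσ), le_rfl, h _ hσ, hq, rfl⟩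

lemma Offers.loop_step {b : Test} (hb : ∀ σ : State, Pre σ.int → b.holds M σ)
    (h₁ : Offers M s q P T₁ Pre Mid L₁) (h₂ : Offers M s q (.loop b P) T₂ Mid Post L₂) :
    Offers M s q (.loop b P) (b.cost + 1 + T₁ + T₂) Pre Post (L₁ ++ L₂) := by
  intro σ hσ hq
  obtain ⟨t₁, σ₁, hrun₁, ht₁, hpo₁, hq₁, hb₁⟩ := h₁ σ hσ hq
  obtain ⟨t₂, σ₂, hrun₂, ht₂, hpo₂, hq₂, hb₂⟩ := h₂ σ₁ hpo₁ hq₁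
  exact ⟨_, _, .loopStep (hb σ hσ) hrun₁ hrun₂, by omega, hpo₂, hq₂,
    by rw [hb₂, hb₁, List.foldl_append]⟩

end Rules

/-- Disjunction of tests. -/
def Test.or (b c : Test) : Test := .not (.and (.not b) (.not c))

lemma Test.or_holds {M : Memory} {σ : State} {b c : Test} :
    (Test.or b c).holds M σ ↔ b.holds M σ ∨ c.holds M σ := by
  simp only [Test.or, Test.holds]; tauto

/-- Twice the signed area of a triangle, as an expression in the coordinates of its corners. -/
def orientExpr (a b c : RExpr × RExpr) : RExpr :=
  .sub (.mul (.sub b.1 a.1) (.sub c.2 a.2)) (.mul (.sub b.2 a.2) (.sub c.1 a.1))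

/-- The inner product `dotAt`, as an expression in the coordinates. -/
def dotExpr (q x y : RExpr × RExpr) : RExpr :=
  .add (.mul (.sub x.1 q.1) (.sub y.1 q.1)) (.mul (.sub x.2 q.2) (.sub y.2 q.2))

/-- The value of a pair of expressions. -/
noncomputable def evalPair (M : Memory) (σ : State) (a : RExpr × RExpr) : ℝ × ℝ :=
  (a.1.eval M σ, a.2.eval M σ)

/-- The pair of real registers `x` and `x + 1`. -/
def regPair (x : ℕ) : RExpr × RExpr := (.reg x, .reg (x + 1))

/-- The vertex with index `e` of the array of points at the address in the integer register `8`. -/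
def vertexPair (e : IExpr) : RExpr × RExpr :=
  (.load (.add (.reg 8) (.add e e)), .load (.add (.add (.reg 8) (.add e e)) (.const 1)))

lemma evalPair_vertexPair {M : Memory} {σ : State} {e : IExpr} {x : ℝ × ℝ}
    (h : M.real (σ.int 8 + 2 * e.eval M σ) = x.1 ∧ M.real (σ.int 8 + 2 * e.eval M σ + 1) = x.2) :
    evalPair M σ (vertexPair e) = x := by
  rw [two_mul] at h
  exact Prod.ext h.1 h.2

/-- The test whether `x` is better than `b` in the sense of `Improves`. -/
def improvesTest (s : ℤ) (q b x : RExpr × RExpr) : Test :=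
  .or (.not (.rle (.mul (.const s) (orientExpr q b x)) (.const 0)))
    (.and (.rle (.const 0) (.mul (.const s) (orientExpr q b x)))
      (.and (.not (.rle (dotExpr q x x) (dotExpr q b x))) (.rle (.const 0) (dotExpr q b x))))

lemma improvesTest_holds {M : Memory} {σ : State} {s : ℤ} {q b x : RExpr × RExpr} :
    (improvesTest s q b x).holds M σ ↔
      Improves s (evalPair M σ q) (evalPair M σ b) (evalPair M σ x) := by
  simp only [improvesTest, Test.or_holds, Test.holds, RExpr.eval, orientExpr, dotExpr, Improves,
    orient, dotAt, evalPair, not_le, Int.cast_zero]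

/-- The test for `LexLe`. -/
def lexTest (τ : ℤ) (a b : RExpr × RExpr) : Test :=
  .and (.rle (.mul (.const τ) a.1) (.mul (.const τ) b.1))
    (.not (.and (.rle (.mul (.const τ) b.1) (.mul (.const τ) a.1))
      (.not (.rle (.mul (.const τ) a.2) (.mul (.const τ) b.2)))))

/-- The test for `GoesOn`, at consecutive points `x` and `y` of the chain. -/
def goesOnTest (τ s : ℤ) (q x y : RExpr × RExpr) : Test :=
  .or (lexTest τ q x) (.rle (.const 0) (.mul (.const s) (orientExpr x y q)))

lemma goesOnTest_holds {M : Memory} {σ : State} {τ s : ℤ} {q x y : RExpr × RExpr} :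
    (goesOnTest τ s q x y).holds M σ ↔ LexLe τ (evalPair M σ q) (evalPair M σ x) ∨
      0 ≤ s * orient (evalPair M σ x) (evalPair M σ y) (evalPair M σ q) := by
  simp only [goesOnTest, lexTest, Test.or_holds, Test.holds, RExpr.eval, orientExpr, LexLe,
    orient, evalPair, Int.cast_zero]

/-- Offer the vertex with index `e`. -/
def offer (s : ℤ) (e : IExpr) : Prog :=
  .seq (.setReal 4 (vertexPair e).1) (.seq (.setReal 5 (vertexPair e).2)
    (.ite (improvesTest s (regPair 2) (regPair 0) (regPair 4))
      (.seq (.setReal 0 (.reg 4)) (.setReal 1 (.reg 5))) .skip))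

lemma eval_int_congr {M : Memory} {σ σ' : State} (h : σ.int = σ'.int) (e : IExpr) :
    e.eval M σ = e.eval M σ' := by
  induction e <;> simp_all [IExpr.eval]

lemma Offers.offer {M : Memory} {s : ℤ} {q x : ℝ × ℝ} {e : IExpr} {Pre Post : (ℕ → ℤ) → Prop}
    (hx : ∀ σ : State, Pre σ.int → M.real (σ.int 8 + 2 * e.eval M σ) = x.1 ∧
      M.real (σ.int 8 + 2 * e.eval M σ + 1) = x.2)
    (h : ∀ ρ, Pre ρ → Post ρ) :
    Offers M s q (GiftWrap.offer s e) (4 * e.cost + 150) Pre Post [x] := by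
  intro σ hσ hq
  have hv := evalPair_vertexPair (hx σ hσ)
  have h4 : (vertexPair e).1.eval M σ = x.1 := congrArg Prod.fst hv
  have h5 : (vertexPair e).2.eval M σ = x.2 := congrArg Prod.snd hv
  -- the registers after the coordinates of the vertex have been loaded
  let σ₁ : State := { σ with real := Function.update σ.real 4 x.1 }
  let σ₂ : State := { σ with real := Function.update (Function.update σ.real 4 x.1) 5 x.2 }
  have r1 : Run M (.setReal 4 (vertexPair e).1) σ ((vertexPair e).1.cost + 1) σ₁ := by
    have := Run.setReal (M := M) 4 (vertexPair e).1 σ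
    rwa [h4] at this
  have r2 : Run M (.setReal 5 (vertexPair e).2) σ₁ ((vertexPair e).2.cost + 1) σ₂ := by
    have := Run.setReal (M := M) 5 (vertexPair e).2 σ₁
    have h5' : (vertexPair e).2.eval M σ₁ = x.2 := by
      rw [← h5]
      simp only [vertexPair, RExpr.eval, IExpr.eval,
        eval_int_congr (M := M) (show σ₁.int = σ.int from rfl) e]
      rfl
    rwa [h5'] at this
  have htest : (improvesTest s (regPair 2) (regPair 0) (regPair 4)).holds M σ₂ ↔
      Improves s q (σ.point 0) x := by
    rw [improvesTest_holds, ← hq]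
    simp [evalPair, regPair, RExpr.eval, σ₂, State.point, Function.update]
  have hcost : (vertexPair e).1.cost + 1 + ((vertexPair e).2.cost + 1 +
      ((improvesTest s (regPair 2) (regPair 0) (regPair 4)).cost + 1 + 4)) ≤ 4 * e.cost + 150 := by
    simp only [vertexPair, RExpr.cost, IExpr.cost, improvesTest, Test.or, Test.cost, orientExpr,
      dotExpr, regPair]
    omega
  by_cases himp : Improves s q (σ.point 0) x
  · refine ⟨_, _, .seq r1 (.seq r2 (.iteTrue (htest.2 himp) (.seq (.setReal _ _ _)
      (.setReal _ _ _)))), hcost, h _ hσ, ?_, ?_⟩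
    · rw [← hq]; simp [State.point, Function.update, σ₂]
    · rw [List.foldl_cons, List.foldl_nil, better, if_pos himp]
      simp [State.point, Function.update, RExpr.eval, σ₂]
  · refine ⟨_, _, .seq r1 (.seq r2 (.iteFalse (fun hc => himp (htest.1 hc)) (.skip _))),
      by omega, h _ hσ, ?_, ?_⟩
    · rw [← hq]; simp [State.point, Function.update, σ₂]
    · rw [List.foldl_cons, List.foldl_nil, better, if_neg himp]
      simp [State.point, Function.update, σ₂]

/-! ### Binary search on a convex chain -/

/-- The array index of the point number `m` of the chain that begins at the index in the integer
register `14` and runs through the array forwards (for `s = 1`) or backwards (for `s = -1`). -/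
def Direction.index : Direction → IExpr → IExpr
  | .clockwise, m => .add (.reg 14) m
  | .counterclockwise, m => .sub (.reg 14) m

lemma Direction.eval_index {M : Memory} {σ : State} (d : Direction) (m : IExpr) :
    (d.index m).eval M σ = σ.int 14 + d.sign * m.eval M σ := by
  cases d <;> simp [Direction.index, Direction.sign, IExpr.eval, sub_eq_add_neg]

lemma Direction.cost_index (d : Direction) (m : IExpr) : (d.index m).cost = m.cost + 2 := by
  cases d <;> simp only [Direction.index, IExpr.cost] <;> omega

/-- One round of the binary search: the integer registers `11` and `12` hold the bounds, `13` the
middle. -/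
def searchStep (d : Direction) (τ : ℤ) : Prog :=
  .seq (.setInt 13 (.half (.add (.reg 11) (.reg 12))))
    (.ite (goesOnTest τ d.sign (regPair 2) (vertexPair (d.index (.reg 13)))
        (vertexPair (d.index (.add (.reg 13) (.const 1)))))
      (.setInt 11 (.add (.reg 13) (.const 1))) (.setInt 12 (.reg 13)))

/-- The search loop. -/
def searchLoop (d : Direction) (τ : ℤ) : Prog :=
  .loop (.not (.ile (.reg 12) (.reg 11))) (searchStep d τ)

/-- Search the chain that begins at the array index `c` and has `len` steps, and offer the point
found. -/
def searchChain (d : Direction) (τ : ℤ) (c len : IExpr) : Prog :=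
  .seq (.setInt 11 (.const 0)) (.seq (.setInt 12 len) (.seq (.setInt 14 c)
    (.seq (searchLoop d τ) (offer d.sign (d.index (.reg 11))))))

/-- The integer registers while a node is processed: the registers `0` to `6` keep the contents `g`,
and `8`, `9`, `10` hold the address of the array of hull vertices, its length, and the index of the
lexicographic minimum. -/
def AtHull (g : ℕ → ℤ) (B : ℤ) (h l : ℕ) (ρ : ℕ → ℤ) : Prop :=
  (∀ x < 7, ρ x = g x) ∧ ρ 8 = B ∧ ρ 9 = h ∧ ρ 10 = l

/-- The points `u 0, …, u L` are stored in the array at address `B` from index `c` on, in steps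
of `δ`. -/
def StoresChain (M : Memory) (B c δ : ℤ) (u : ℕ → ℝ × ℝ) (L : ℕ) : Prop :=
  ∀ m : ℕ, m ≤ L → M.real (B + 2 * (c + δ * m)) = (u m).1 ∧
    M.real (B + 2 * (c + δ * m) + 1) = (u m).2

/-- The integer registers during the search. -/
def Searching (g : ℕ → ℤ) (B : ℤ) (h l : ℕ) (c lo hi : ℤ) (ρ : ℕ → ℤ) : Prop :=
  AtHull g B h l ρ ∧ ρ 14 = c ∧ ρ 11 = lo ∧ ρ 12 = hi

lemma atHull_update {g : ℕ → ℤ} {B : ℤ} {h l : ℕ} {ρ : ℕ → ℤ} (hρ : AtHull g B h l ρ) {x : ℕ}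
    (hx : 10 < x) (a : ℤ) : AtHull g B h l (Function.update ρ x a) := by
  obtain ⟨h1, h2, h3, h4⟩ := hρ
  refine ⟨fun y hy => ?_, ?_, ?_, ?_⟩
  · rw [Function.update_of_ne (by omega)]; exact h1 y hy
  all_goals rw [Function.update_of_ne (by omega)]; assumption

section Search

variable {M : Memory} {d : Direction} {τ : ℤ} {q : ℝ × ℝ} {g : ℕ → ℤ} {B c : ℤ} {h l : ℕ}
  {u : ℕ → ℝ × ℝ} {L : ℕ}

lemma offers_searchStep (hu : StoresChain M B c d.sign u L) {lo hi : ℕ} (hlt : lo < hi)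
    (hL : hi ≤ L) :
    (GoesOn τ d.sign q u ((lo + hi) / 2) → Offers M d.sign q (searchStep d τ) 200
      (Searching g B h l c lo hi) (Searching g B h l c ((lo + hi) / 2 + 1 : ℕ) hi) []) ∧
    (¬ GoesOn τ d.sign q u ((lo + hi) / 2) → Offers M d.sign q (searchStep d τ) 200
      (Searching g B h l c lo hi) (Searching g B h l c lo ((lo + hi) / 2 : ℕ)) []) := by
  set mid := (lo + hi) / 2 with hmid
  have h1 : Offers M d.sign q (.setInt 13 (.half (.add (.reg 11) (.reg 12)))) 5
      (Searching g B h l c lo hi) (fun ρ => Searching g B h l c lo hi ρ ∧ ρ 13 = mid) [] := by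
    refine Offers.setInt fun σ hσ => ?_
    obtain ⟨ha, h14, h11, h12⟩ := hσ
    refine ⟨⟨atHull_update ha (by norm_num) _, ?_, ?_, ?_⟩, ?_⟩
    · rwa [Function.update_of_ne (by norm_num)]
    · rwa [Function.update_of_ne (by norm_num)]
    · rwa [Function.update_of_ne (by norm_num)]
    · rw [Function.update_self]
      simp only [IExpr.eval, h11, h12, hmid]
      push_cast; rfl
  have htest : ∀ σ : State, (Searching g B h l c lo hi σ.int ∧ σ.int 13 = mid) →
      σ.point 2 = q → ((goesOnTest τ d.sign (regPair 2) (vertexPair (d.index (.reg 13)))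
        (vertexPair (d.index (.add (.reg 13) (.const 1))))).holds M σ ↔
        GoesOn τ d.sign q u mid) := by
    rintro σ ⟨⟨ha, h14, h11, h12⟩, h13⟩ hq
    have hq' : evalPair M σ (regPair 2) = q := hq
    have e1 : evalPair M σ (vertexPair (d.index (.reg 13))) = u mid := by
      refine evalPair_vertexPair ?_
      rw [Direction.eval_index, h14, ha.2.1]
      simp only [IExpr.eval, h13]
      exact hu mid (by omega)
    have e2 : evalPair M σ (vertexPair (d.index (.add (.reg 13) (.const 1)))) = u (mid + 1) := by
      refine evalPair_vertexPair ?_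
      rw [Direction.eval_index, h14, ha.2.1]
      simp only [IExpr.eval, h13]
      exact_mod_cast hu (mid + 1) (by omega)
    rw [goesOnTest_holds, hq', e1, e2, GoesOn]
  have hcost : 5 + ((goesOnTest τ d.sign (regPair 2) (vertexPair (d.index (.reg 13)))
      (vertexPair (d.index (.add (.reg 13) (.const 1))))).cost + 1 + 4) ≤ 200 := by
    simp only [goesOnTest, lexTest, Test.or, Test.cost, orientExpr, regPair, vertexPair,
      RExpr.cost, IExpr.cost, Direction.cost_index]
    omega
  constructor
  · intro hβ
    refine (h1.seq (Offers.ite (T := 4) _ htest (fun _ => Offers.setInt fun σ hσ => ?_)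
      (fun h => absurd hβ h))).mono (fun _ => id) (fun _ => id) hcost
    obtain ⟨⟨ha, h14, h11, h12⟩, h13⟩ := hσ
    refine ⟨atHull_update ha (by norm_num) _, ?_, ?_, ?_⟩
    · rwa [Function.update_of_ne (by norm_num)]
    · rw [Function.update_self]
      simp only [IExpr.eval, h13]
      push_cast; rfl
    · rwa [Function.update_of_ne (by norm_num)]
  · intro hβ
    refine (h1.seq (Offers.ite (T := 4) _ htest (fun h => absurd h hβ)
      (fun _ => (Offers.setInt (Post := Searching g B h l c lo mid) fun σ hσ => ?_).mono
        (fun _ => id) (fun _ => id) (by simp [IExpr.cost])))).mono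
        (fun _ => id) (fun _ => id) hcost
    obtain ⟨⟨ha, h14, h11, h12⟩, h13⟩ := hσ
    refine ⟨atHull_update ha (by norm_num) _, ?_, ?_, ?_⟩
    · rwa [Function.update_of_ne (by norm_num)]
    · rwa [Function.update_of_ne (by norm_num)]
    · rw [Function.update_self]
      exact h13

/-- The loop stops at the point `k₀` at which the test switches from true to false. -/
lemma offers_searchLoop (hu : StoresChain M B c d.sign u L) (k : ℕ) :
    ∀ lo hi : ℕ, lo ≤ hi → hi ≤ L → hi - lo < 2 ^ k →
    ∃ κ, κ ≤ L ∧ (∀ k₀, lo ≤ k₀ → k₀ ≤ hi →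
        (∀ m < L, GoesOn τ d.sign q u m ↔ m < k₀) → κ = k₀) ∧
      ∀ g, Offers M d.sign q (searchLoop d τ) (210 * k + 10) (Searching g B h l c lo hi)
        (fun ρ => AtHull g B h l ρ ∧ ρ 14 = c ∧ ρ 11 = κ) [] := by
  have hdone : ∀ (k lo hi : ℕ), lo = hi → hi ≤ L → ∃ κ, κ ≤ L ∧ (∀ k₀, lo ≤ k₀ → k₀ ≤ hi →
        (∀ m < L, GoesOn τ d.sign q u m ↔ m < k₀) → κ = k₀) ∧
      ∀ g, Offers M d.sign q (searchLoop d τ) (210 * k + 10) (Searching g B h l c lo hi)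
        (fun ρ => AtHull g B h l ρ ∧ ρ 14 = c ∧ ρ 11 = κ) [] := by
    rintro k lo _ rfl hL
    refine ⟨lo, hL, fun k₀ h1 h2 _ => le_antisymm h1 h2, fun g => ?_⟩
    refine (Offers.loop_done (fun σ hσ => ?_) fun ρ hρ => ⟨hρ.1, hρ.2.1, hρ.2.2.1⟩).mono
      (fun _ => id) (fun _ => id) (by simp [Test.cost, IExpr.cost])
    simp [Test.holds, IExpr.eval, hσ.2.2.1, hσ.2.2.2]
  induction k with
  | zero =>
    intro lo hi hle hL hk
    exact hdone 0 lo hi (by rw [pow_zero] at hk; omega) hL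
  | succ k ih =>
    intro lo hi hle hL hk
    rcases hle.eq_or_lt with heq | hlt
    · exact hdone (k + 1) lo hi heq hL
    have hcond : ∀ g (σ : State), Searching g B h l c lo hi σ.int →
        (Test.not (.ile (.reg 12) (.reg 11))).holds M σ := by
      intro g σ hσ
      simp [Test.holds, IExpr.eval, hσ.2.2.1, hσ.2.2.2, hlt]
    have hT : (Test.not (.ile (.reg 12) (.reg 11))).cost + 1 + 200 + (210 * k + 10)
        ≤ 210 * (k + 1) + 10 := by
      simp only [Test.cost, IExpr.cost]; omega
    rw [pow_succ] at hk
    by_cases hβ : GoesOn τ d.sign q u ((lo + hi) / 2)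
    · obtain ⟨κ, hκL, hκ, hrun⟩ := ih ((lo + hi) / 2 + 1) hi (by omega) hL (by omega)
      refine ⟨κ, hκL, fun k₀ h1 h2 h3 => hκ k₀ ?_ h2 h3, fun g => ?_⟩
      · exact (h3 _ (by omega)).1 hβ
      · exact (Offers.loop_step (hcond g) ((offers_searchStep hu hlt hL).1 hβ) (hrun g)).mono
          (fun _ => id) (fun _ => id) hT
    · obtain ⟨κ, hκL, hκ, hrun⟩ := ih lo ((lo + hi) / 2) (by omega) (by omega) (by omega)
      refine ⟨κ, hκL, fun k₀ h1 h2 h3 => hκ k₀ h1 ?_ h3, fun g => ?_⟩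
      · by_contra! hc
        exact hβ ((h3 _ (by omega)).2 hc)
      · exact (Offers.loop_step (hcond g) ((offers_searchStep hu hlt hL).2 hβ) (hrun g)).mono
          (fun _ => id) (fun _ => id) hT

/-- Searching a convex chain offers a point of the chain, namely the tangent point if it is an
inner point of the chain. -/
lemma offers_searchChain (hτ : (τ : ℝ) = 1 ∨ (τ : ℝ) = -1) (hu : StoresChain M B c d.sign u L)
    (hchain : IsConvexChain τ d.sign u L) {k : ℕ} (hk : L < 2 ^ k) {ce len : IExpr}
    (hce : ∀ (g : ℕ → ℤ) (σ : State), AtHull g B h l σ.int → ce.eval M σ = c)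
    (hlen : ∀ (g : ℕ → ℤ) (σ : State), AtHull g B h l σ.int → len.eval M σ = L) :
    ∃ κ ≤ L, (∀ k₀, 0 < k₀ → k₀ < L → IsTangentPoint d.sign (u '' Set.Iic L) q (u k₀) →
        κ = k₀) ∧
      ∀ g, Offers M d.sign q (searchChain d τ ce len) (210 * k + 200 + ce.cost + len.cost)
        (AtHull g B h l) (AtHull g B h l) [u κ] := by
  obtain ⟨κ, hκL, hκ, hrun⟩ := offers_searchLoop (τ := τ) (q := q) (h := h) (l := l) hu k 0 L
    (Nat.zero_le L) le_rfl (by omega)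
  refine ⟨κ, hκL, fun k₀ h1 h2 h3 => hκ k₀ h1.le h2.le fun m hm =>
    hchain.goesOn_iff hτ h1 h2 h3 hm, fun g => ?_⟩
  have s1 : Offers M d.sign q (.setInt 11 (.const 0)) 2 (AtHull g B h l)
      (fun ρ => AtHull g B h l ρ ∧ ρ 11 = (0 : ℕ)) [] :=
    Offers.setInt fun σ hσ => ⟨atHull_update hσ (by norm_num) _, by simp [IExpr.eval]⟩
  have s2 : Offers M d.sign q (.setInt 12 len) (len.cost + 1)
      (fun ρ => AtHull g B h l ρ ∧ ρ 11 = (0 : ℕ))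
      (fun ρ => AtHull g B h l ρ ∧ ρ 11 = (0 : ℕ) ∧ ρ 12 = L) [] :=
    Offers.setInt fun σ hσ => ⟨atHull_update hσ.1 (by norm_num) _,
      by rw [Function.update_of_ne (by norm_num)]; exact hσ.2,
      by rw [Function.update_self]; exact hlen g σ hσ.1⟩
  have s3 : Offers M d.sign q (.setInt 14 ce) (ce.cost + 1)
      (fun ρ => AtHull g B h l ρ ∧ ρ 11 = (0 : ℕ) ∧ ρ 12 = L)
      (Searching g B h l c (0 : ℕ) L) [] :=
    Offers.setInt fun σ hσ => ⟨atHull_update hσ.1 (by norm_num) _,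
      by rw [Function.update_self]; exact hce g σ hσ.1,
      by rw [Function.update_of_ne (by norm_num)]; exact hσ.2.1,
      by rw [Function.update_of_ne (by norm_num)]; exact hσ.2.2⟩
  have s4 : Offers M d.sign q (offer d.sign (d.index (.reg 11)))
      (4 * (d.index (.reg 11)).cost + 150)
      (fun ρ => AtHull g B h l ρ ∧ ρ 14 = c ∧ ρ 11 = κ) (AtHull g B h l) [u κ] := by
    refine Offers.offer (fun σ hσ => ?_) fun ρ hρ => hρ.1
    rw [Direction.eval_index, hσ.2.1, hσ.1.2.1]
    simp only [IExpr.eval, hσ.2.2]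
    exact hu κ hκL
  refine (s1.seq (s2.seq (s3.seq ((hrun g).seq s4)))).mono (fun _ => id) (fun _ => id) ?_
  rw [Direction.cost_index]
  simp only [IExpr.cost]
  omega

end Search

/-! ### Processing a node -/

/-- Offer the ends and the middle of the array and the lexicographic minimum, and search the two
chains from the one to the other extreme vertex, in the sense in which a tangent point is found. -/
def offerHull (d : Direction) : Prog :=
  .seq (offer d.sign (.const 0)) (.seq (offer d.sign (.half (.reg 9)))
    (.seq (offer d.sign (.sub (.reg 9) (.const 1))) (.seq (offer d.sign (.reg 10))
      (match d with
        | .clockwise => .seq (searchChain d 1 (.const 0) (.reg 10))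
            (searchChain d (-1) (.reg 10) (.sub (.sub (.reg 9) (.const 1)) (.reg 10)))
        | .counterclockwise => .seq (searchChain d (-1) (.reg 10) (.reg 10))
            (searchChain d 1 (.sub (.reg 9) (.const 1))
              (.sub (.sub (.reg 9) (.const 1)) (.reg 10)))))))

/-- Process the node whose record has its address in the integer register `7`. -/
def offerNode (d : Direction) : Prog :=
  .seq (.setInt 8 (.load (.add (.reg 7) (.const 7))))
    (.seq (.setInt 9 (.load (.add (.reg 7) (.const 5))))
      (.seq (.setInt 10 (.load (.add (.reg 7) (.const 6)))) (offerHull d)))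

/-- A list of candidates that suffices for the point set `S`: it contains all tangent points that
are hull vertices, and lies on a line through `q` only if `S` does. -/
structure IsCandidateList (s : ℝ) (q : ℝ × ℝ) (S : Set (ℝ × ℝ)) (L : List (ℝ × ℝ)) : Prop where
  mem : ∀ x ∈ L, x ∈ S
  tangent : ∀ t ∈ hullVertices S, IsTangentPoint s S q t → t ∈ L
  line : ∀ t, t ≠ q → (∀ x ∈ L, orient q t x = 0) → ∀ x ∈ S, orient q t x = 0

lemma IsHullArray.isCandidateList {s : ℝ} {q : ℝ × ℝ} {S : Set (ℝ × ℝ)} (hS : S.Finite)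
    {h l : ℕ} {v : ℕ → ℝ × ℝ} (H : IsHullArray S h l v) {κ₁ κ₂ : ℕ} (hκ₁ : κ₁ < h) (hκ₂ : κ₂ < h)
    (h₁ : ∀ k, 0 < k → k < l → IsTangentPoint s S q (v k) → κ₁ = k)
    (h₂ : ∀ k, l < k → k < h - 1 → IsTangentPoint s S q (v k) → κ₂ = k) :
    IsCandidateList s q S [v 0, v (h / 2), v (h - 1), v l, v κ₁, v κ₂] where
  mem := by
    have := H.pos
    have hm := fun k hk => H.mem (k := k) hk
    simp only [List.mem_cons, List.not_mem_nil, or_false, forall_eq_or_imp, forall_eq]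
    exact ⟨hm _ (by omega), hm _ (by omega), hm _ (by omega), hm _ H.min_index, hm _ hκ₁,
      hm _ hκ₂⟩
  tangent t ht hst := by
    rw [← H.vertices] at ht
    obtain ⟨k, hk, rfl⟩ := ht
    have hk : k < h := hk
    have hl := H.min_index
    have : k = 0 ∨ k = l ∨ k = h - 1 ∨ (0 < k ∧ k < l) ∨ (l < k ∧ k < h - 1) := by omega
    rcases this with rfl | rfl | rfl | ⟨ha, hb⟩ | ⟨ha, hb⟩
    · simp
    · simp
    · simp
    · simp [h₁ k ha hb hst]
    · simp [h₂ k ha hb hst]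
  line t htq h0 := H.collinear hS htq (h0 _ (by simp)) (h0 _ (by simp)) (h0 _ (by simp))

lemma offers_offerHull {M : Memory} (d : Direction) {q : ℝ × ℝ} {S : Set (ℝ × ℝ)} (hS : S.Finite)
    {h l : ℕ} {v : ℕ → ℝ × ℝ} (H : IsHullArray S h l v) {B : ℤ}
    (hv : ∀ k < h, M.real (B + 2 * k) = (v k).1 ∧ M.real (B + 2 * k + 1) = (v k).2)
    {k : ℕ} (hk : h ≤ 2 ^ k) :
    ∃ L, IsCandidateList d.sign q S L ∧ ∀ g, Offers M d.sign q (offerHull d) (420 * k + 1200)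
      (AtHull g B h l) (AtHull g B h l) L := by
  have hpos := H.pos
  have hl := H.min_index
  have hv' : ∀ (a : ℤ) (k : ℕ), k < h → a = k →
      M.real (B + 2 * a) = (v k).1 ∧ M.real (B + 2 * a + 1) = (v k).2 := by
    rintro a k hk rfl
    exact hv k hk
  have o : ∀ (g : ℕ → ℤ) (e : IExpr) (k : ℕ), k < h → e.cost ≤ 3 →
      (∀ σ : State, AtHull g B h l σ.int → e.eval M σ = k) →
      Offers M d.sign q (offer d.sign e) 162 (AtHull g B h l) (AtHull g B h l) [v k] := by
    intro g e k hk hcost he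
    refine (Offers.offer (fun σ hσ => ?_) fun _ => id).mono (fun _ => id) (fun _ => id)
      (by omega : 4 * e.cost + 150 ≤ 162)
    rw [hσ.2.1]
    exact hv' _ k hk (he σ hσ)
  have o1 := fun g => o g (.const 0) 0 hpos (by simp [IExpr.cost]) fun σ hσ => by
    simp [IExpr.eval]
  have o2 := fun g => o g (.half (.reg 9)) (h / 2) (by omega) (by simp [IExpr.cost]) fun σ hσ => by
    simp [IExpr.eval, hσ.2.2.1]
  have o3 := fun g => o g (.sub (.reg 9) (.const 1)) (h - 1) (by omega) (by simp [IExpr.cost])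
    fun σ hσ => by simp only [IExpr.eval, hσ.2.2.1]; omega
  have o4 := fun g => o g (.reg 10) l hl (by simp [IExpr.cost]) fun σ hσ => by
    simp [IExpr.eval, hσ.2.2.2]
  have hmono : ∀ {L : ℕ} {u : ℕ → ℝ × ℝ} {k : ℕ}, (∀ m ≤ L, u m ∈ S) → k ≤ L →
      IsTangentPoint d.sign S q (u k) → IsTangentPoint d.sign (u '' Set.Iic L) q (u k) :=
    fun hu hk ht => ht.mono (by rintro _ ⟨m, hm, rfl⟩; exact hu m hm) ⟨_, hk, rfl⟩
  cases d
  · obtain ⟨κ₁, hκ₁, ht₁, s1⟩ := offers_searchChain (M := M) (d := .clockwise) (τ := 1) (q := q)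
      (B := B) (c := 0) (h := h) (l := l) (u := v) (L := l) (k := k) (ce := .const 0)
      (len := .reg 10) (by simp)
      (fun m hm => hv' _ m (by omega) (by simp [Direction.sign]))
      (by simpa [Direction.sign] using H.chain_lower) (by omega) (fun g σ hσ => rfl)
      (fun g σ hσ => by simp [IExpr.eval, hσ.2.2.2])
    obtain ⟨κ₂, hκ₂, ht₂, s2⟩ := offers_searchChain (M := M) (d := .clockwise) (τ := -1) (q := q)
      (B := B) (c := l) (h := h) (l := l) (u := fun m => v (l + m)) (L := h - 1 - l) (k := k)
      (ce := .reg 10) (len := .sub (.sub (.reg 9) (.const 1)) (.reg 10)) (by simp)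
      (fun m hm => hv' _ (l + m) (by omega) (by simp [Direction.sign]))
      (by simpa [Direction.sign] using H.chain_upper) (by omega)
      (fun g σ hσ => by simp [IExpr.eval, hσ.2.2.2])
      (fun g σ hσ => by simp only [IExpr.eval, hσ.2.2.1, hσ.2.2.2]; omega)
    refine ⟨_, H.isCandidateList hS (κ₁ := κ₁) (κ₂ := l + κ₂) (by omega) (by omega)
      (fun k h1 h2 h3 => ht₁ k h1 h2 (hmono (fun m hm => H.mem (by omega)) h2.le h3))
      (fun k h1 h2 h3 => ?_), fun g => ((o1 g).seq ((o2 g).seq ((o3 g).seq ((o4 g).seq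
        ((s1 g).seq (s2 g)))))).mono (fun _ => id) (fun _ => id) ?_⟩
    · have := ht₂ (k - l) (by omega) (by omega) (hmono (u := fun m => v (l + m))
        (fun m hm => H.mem (by omega)) (by omega) (by rwa [show l + (k - l) = k by omega]))
      omega
    · simp only [IExpr.cost]; omega
  · obtain ⟨κ₁, hκ₁, ht₁, s1⟩ := offers_searchChain (M := M) (d := .counterclockwise) (τ := -1)
      (q := q) (B := B) (c := l) (h := h) (l := l) (u := fun m => v (l - m)) (L := l) (k := k)
      (ce := .reg 10) (len := .reg 10) (by simp)
      (fun m hm => hv' _ (l - m) (by omega) (by simp [Direction.sign]; omega))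
      (by simpa [Direction.sign] using H.chain_lower_reverse) (by omega)
      (fun g σ hσ => by simp [IExpr.eval, hσ.2.2.2])
      (fun g σ hσ => by simp [IExpr.eval, hσ.2.2.2])
    obtain ⟨κ₂, hκ₂, ht₂, s2⟩ := offers_searchChain (M := M) (d := .counterclockwise) (τ := 1)
      (q := q) (B := B) (c := h - 1) (h := h) (l := l) (u := fun m => v (h - 1 - m))
      (L := h - 1 - l) (k := k) (ce := .sub (.reg 9) (.const 1))
      (len := .sub (.sub (.reg 9) (.const 1)) (.reg 10)) (by simp)
      (fun m hm => hv' _ (h - 1 - m) (by omega) (by simp [Direction.sign]; omega))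
      (by simpa [Direction.sign] using H.chain_upper_reverse) (by omega)
      (fun g σ hσ => by simp [IExpr.eval, hσ.2.2.1])
      (fun g σ hσ => by simp only [IExpr.eval, hσ.2.2.1, hσ.2.2.2]; omega)
    refine ⟨_, H.isCandidateList hS (κ₁ := l - κ₁) (κ₂ := h - 1 - κ₂) (by omega) (by omega)
      (fun k h1 h2 h3 => ?_) (fun k h1 h2 h3 => ?_), fun g => ((o1 g).seq ((o2 g).seq ((o3 g).seq
        ((o4 g).seq ((s1 g).seq (s2 g)))))).mono (fun _ => id) (fun _ => id) ?_⟩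
    · have := ht₁ (l - k) (by omega) (by omega) (hmono (u := fun m => v (l - m))
        (fun m hm => H.mem (by omega)) (by omega) (by rwa [show l - (l - k) = k by omega]))
      omega
    · have := ht₂ (h - 1 - k) (by omega) (by omega) (hmono (u := fun m => v (h - 1 - m))
        (fun m hm => H.mem (by omega)) (by omega)
        (by rwa [show h - 1 - (h - 1 - k) = k by omega]))
      omega
    · simp only [IExpr.cost]; omega

lemma offers_offerNode {M : Memory} (d : Direction) {q : ℝ × ℝ} {F : Finset (ℝ × ℝ)} {a : ℤ}
    (hM : StoresHull M a F) {k : ℕ} (hk : F.card ≤ 2 ^ k) :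
    ∃ L, IsCandidateList d.sign q F L ∧ ∀ g : ℕ → ℤ, Offers M d.sign q (offerNode d)
      (420 * k + 1215) (fun ρ => (∀ x < 7, ρ x = g x) ∧ ρ 7 = a) (fun ρ => ∀ x < 7, ρ x = g x)
      L := by
  obtain ⟨h, l, v, H, h5, h6, hv⟩ := hM
  obtain ⟨L, hL, hrun⟩ := offers_offerHull (M := M) d (q := q) F.finite_toSet H (B := M.int (a + 7))
    hv ((H.le_card subset_rfl).trans hk)
  refine ⟨L, hL, fun g => ?_⟩
  have s1 : Offers M d.sign q (.setInt 8 (.load (.add (.reg 7) (.const 7)))) 5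
      (fun ρ => (∀ x < 7, ρ x = g x) ∧ ρ 7 = a)
      (fun ρ => (∀ x < 7, ρ x = g x) ∧ ρ 7 = a ∧ ρ 8 = M.int (a + 7)) [] := by
    refine Offers.setInt fun σ hσ => ⟨fun x hx => ?_, ?_, ?_⟩
    · rw [Function.update_of_ne (by omega)]; exact hσ.1 x hx
    · rw [Function.update_of_ne (by norm_num)]; exact hσ.2
    · simp [IExpr.eval, hσ.2]
  have s2 : Offers M d.sign q (.setInt 9 (.load (.add (.reg 7) (.const 5)))) 5
      (fun ρ => (∀ x < 7, ρ x = g x) ∧ ρ 7 = a ∧ ρ 8 = M.int (a + 7))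
      (fun ρ => (∀ x < 7, ρ x = g x) ∧ ρ 7 = a ∧ ρ 8 = M.int (a + 7) ∧ ρ 9 = h) [] := by
    refine Offers.setInt fun σ hσ => ⟨fun x hx => ?_, ?_, ?_, ?_⟩
    · rw [Function.update_of_ne (by omega)]; exact hσ.1 x hx
    · rw [Function.update_of_ne (by norm_num)]; exact hσ.2.1
    · rw [Function.update_of_ne (by norm_num)]; exact hσ.2.2
    · simp [IExpr.eval, hσ.2.1, h5]
  have s3 : Offers M d.sign q (.setInt 10 (.load (.add (.reg 7) (.const 6)))) 5
      (fun ρ => (∀ x < 7, ρ x = g x) ∧ ρ 7 = a ∧ ρ 8 = M.int (a + 7) ∧ ρ 9 = h)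
      (AtHull g (M.int (a + 7)) h l) [] := by
    refine Offers.setInt fun σ hσ => ⟨fun x hx => ?_, ?_, ?_, ?_⟩
    · rw [Function.update_of_ne (by omega)]; exact hσ.1 x hx
    · rw [Function.update_of_ne (by norm_num)]; exact hσ.2.2.1
    · rw [Function.update_of_ne (by norm_num)]; exact hσ.2.2.2
    · simp [IExpr.eval, hσ.2.1, h6]
  exact (s1.seq (s2.seq (s3.seq (hrun g)))).mono (fun _ => id) (fun _ hρ => hρ.1) (by omega)

/-! ### The canonical cover of a window -/

/-- The nodes of the canonical cover of the leaves below the nodes `(κ, l), …, (κ, r)`: the ends of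
the row that are not paired with a sibling in the row, and the cover of the row of the parents of
the remaining nodes. -/
def coverNodes (κ l r : ℕ) : List (ℕ × ℕ) :=
  if l < r then
    (if l % 2 = 1 then [(κ, l)] else []) ++ ((if r % 2 = 0 then [(κ, r)] else []) ++
      coverNodes (κ + 1) ((l + 1) / 2) ((r - 1) / 2))
  else if l = r then [(κ, l)] else []
termination_by r - l
decreasing_by omega

lemma coverNodes_of_lt {κ l r : ℕ} (h : l < r) : coverNodes κ l r =
    (if l % 2 = 1 then [(κ, l)] else []) ++ ((if r % 2 = 0 then [(κ, r)] else []) ++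
      coverNodes (κ + 1) ((l + 1) / 2) ((r - 1) / 2)) := by
  rw [coverNodes, if_pos h]

lemma coverNodes_self (κ l : ℕ) : coverNodes κ l l = [(κ, l)] := by
  rw [coverNodes, if_neg (lt_irrefl _), if_pos rfl]

lemma coverNodes_of_gt {κ l r : ℕ} (h : r < l) : coverNodes κ l r = [] := by
  rw [coverNodes, if_neg h.not_gt, if_neg h.ne']

lemma length_coverNodes_le (k : ℕ) : ∀ κ l r : ℕ, r + 1 - l ≤ 2 ^ k →
    (coverNodes κ l r).length ≤ 2 * k + 1 := by
  induction k with
  | zero =>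
    intro κ l r h
    rw [pow_zero] at h
    rcases lt_trichotomy l r with hlt | rfl | hgt
    · omega
    · simp [coverNodes_self]
    · simp [coverNodes_of_gt hgt]
  | succ k ih =>
    intro κ l r h
    rw [pow_succ] at h
    rcases lt_trichotomy l r with hlt | rfl | hgt
    · have := ih (κ + 1) ((l + 1) / 2) ((r - 1) / 2) (by omega)
      rw [coverNodes_of_lt hlt, List.length_append, List.length_append]
      split_ifs <;> simp only [List.length_cons, List.length_nil] <;> omega
    · simp [coverNodes_self]
    · simp [coverNodes_of_gt hgt]

/-- The rows of nodes that the construction of the cover passes through.  A row may be empty, with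
`l = r + 1`, but `(κ, l)` and `(κ, r)` are nodes even then. -/
structure IsRow (n κ l r : ℕ) : Prop where
  left : IsNode n (κ, l)
  right : IsNode n (κ, r)
  le : l ≤ r + 1

lemma isNode_of_le {n κ a b : ℕ} (h : IsNode n (κ, b)) (hab : a ≤ b) : IsNode n (κ, a) :=
  ⟨h.1, (Nat.mul_le_mul_right _ hab).trans_lt h.2⟩

lemma isNode_parent {n κ m : ℕ} (hpos : 0 < m)
    (h : IsNode n (κ, m)) : IsNode n (κ + 1, m / 2) := by
  have h2 : m * 2 ^ κ < n := h.2
  refine ⟨?_, ?_⟩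
  · refine Nat.succ_le_of_lt ((Nat.lt_clog_iff_pow_lt one_lt_two).2 ?_)
    exact lt_of_le_of_lt (Nat.le_mul_of_pos_left _ hpos) h2
  · change m / 2 * 2 ^ (κ + 1) < n
    rw [pow_succ]
    calc m / 2 * (2 ^ κ * 2) = (m / 2 * 2) * 2 ^ κ := by ring
      _ ≤ m * 2 ^ κ := Nat.mul_le_mul_right _ (by omega)
      _ < n := h2

lemma IsRow.parents {n κ l r : ℕ} (h : IsRow n κ l r) (hlt : l < r) :
    IsRow n (κ + 1) ((l + 1) / 2) ((r - 1) / 2) := by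
  have hr : IsNode n (κ + 1, r / 2) := isNode_parent (by omega) h.right
  exact ⟨isNode_of_le hr (by omega), isNode_of_le hr (by omega), by omega⟩

lemma isNode_of_mem_coverNodes {n : ℕ} (κ l r : ℕ) (h : IsRow n κ l r) :
    ∀ v ∈ coverNodes κ l r, IsNode n v := by
  induction κ, l, r using coverNodes.induct with
  | case1 κ l r hlt ih =>
    intro v hv
    rw [coverNodes_of_lt hlt, List.mem_append, List.mem_append] at hv
    rcases hv with hv | hv | hv
    · split_ifs at hv
      · rw [List.mem_singleton.1 hv]; exact h.left
      · simp at hv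
    · split_ifs at hv
      · rw [List.mem_singleton.1 hv]; exact h.right
      · simp at hv
    · exact ih (h.parents hlt) v hv
  | case2 κ r hlt =>
    intro v hv
    rw [coverNodes_self, List.mem_singleton] at hv
    rw [hv]; exact h.left
  | case3 κ l r hlt hne =>
    rw [coverNodes_of_gt (by omega)]
    simp

lemma mem_canonicalSubset {n κ m t : ℕ} :
    t ∈ canonicalSubset n (κ, m) ↔ m ≤ t / 2 ^ κ ∧ t / 2 ^ κ ≤ m ∧ t < n := by
  have hp : 0 < 2 ^ κ := by positivity
  have h : t / 2 ^ κ ≤ m ↔ t < (m + 1) * 2 ^ κ := by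
    rw [← Nat.lt_succ_iff, Nat.div_lt_iff_lt_mul hp]
  rw [canonicalSubset, Finset.mem_Ico, lt_min_iff, Nat.le_div_iff_mul_le hp, h]

lemma exists_mem_coverNodes_iff {n t : ℕ} (κ l r : ℕ) (h : l ≤ r + 1) :
    (∃ v ∈ coverNodes κ l r, t ∈ canonicalSubset n v) ↔
      l ≤ t / 2 ^ κ ∧ t / 2 ^ κ ≤ r ∧ t < n := by
  induction κ, l, r using coverNodes.induct with
  | case1 κ l r hlt ih =>
    have hdiv : t / 2 ^ (κ + 1) = t / 2 ^ κ / 2 := by rw [pow_succ, Nat.div_div_eq_div_mul]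
    have ih := ih (by omega)
    rw [hdiv] at ih
    simp only [coverNodes_of_lt hlt, List.mem_append, or_and_right, exists_or, ih]
    have h1 : ∀ (P : Prop) [Decidable P] (m : ℕ),
        (∃ v ∈ (if P then [(κ, m)] else []), t ∈ canonicalSubset n v) ↔
          P ∧ m ≤ t / 2 ^ κ ∧ t / 2 ^ κ ≤ m ∧ t < n := by
      intro P _ m
      split_ifs with hP
      · simp [hP, mem_canonicalSubset]
      · simp [hP]
    simp only [h1]
    omega
  | case2 κ r hlt => simp [coverNodes_self, mem_canonicalSubset]
  | case3 κ l r hlt hne =>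
    rw [coverNodes_of_gt (by omega)]
    simp only [List.not_mem_nil, false_and, exists_false, false_iff]
    omega

lemma biUnion_coverNodes {n i j : ℕ} (hij : i ≤ j) (hj : j < n) :
    (coverNodes 0 i j).toFinset.biUnion (canonicalSubset n) = Finset.Icc i j := by
  ext t
  rw [Finset.mem_biUnion]
  simp only [List.mem_toFinset]
  rw [exists_mem_coverNodes_iff 0 i j (by omega), pow_zero, Nat.div_one, Finset.mem_Icc]
  omega

/-! ### Traversing the cover -/

/-- Process the node at the address in the integer register `x`. -/
def offerNodeAt (d : Direction) (x : ℕ) : Prog := .seq (.setInt 7 (.reg x)) (offerNode d)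

/-- The test whether the integer register `x` is even. -/
def evenTest (x : ℕ) : Test := .ile (.reg x) (.add (.half (.reg x)) (.half (.reg x)))

/-- Process the left end of the row if it is a right child, and move on to the next node. -/
def leftStep (d : Direction) : Prog :=
  .ite (evenTest 5) .skip (.seq (offerNodeAt d 3)
    (.seq (.setInt 3 (.load (.add (.reg 3) (.const 4)))) (.setInt 5 (.add (.reg 5) (.const 1)))))

/-- Process the right end of the row if it is a left child, and move on to the previous node. -/
def rightStep (d : Direction) : Prog :=
  .ite (evenTest 6) (.seq (offerNodeAt d 4)
    (.seq (.setInt 4 (.load (.add (.reg 4) (.const 3)))) (.setInt 6 (.sub (.reg 6) (.const 1)))))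
    .skip

/-- Replace the row by the row of the parents. -/
def parentStep : Prog :=
  .seq (.setInt 3 (.load (.reg 3))) (.seq (.setInt 4 (.load (.reg 4)))
    (.seq (.setInt 5 (.half (.reg 5))) (.setInt 6 (.half (.reg 6)))))

/-- One level of the traversal.  The integer registers `3` and `4` hold the addresses of the ends
of the row, `5` and `6` their positions.  A row of one node is processed and then made empty without
following the link to the next node, which need not exist. -/
def levelStep (d : Direction) : Prog :=
  .ite (.ile (.reg 6) (.reg 5)) (.seq (offerNodeAt d 3) (.setInt 5 (.add (.reg 5) (.const 1))))
    (.seq (leftStep d) (.seq (rightStep d) parentStep))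

/-- The loop over the levels, until the row is empty. -/
def coverLoop (d : Direction) : Prog := .loop (.ile (.reg 5) (.reg 6)) (levelStep d)

/-- One pass over the nodes of the canonical cover. -/
def coverPass (d : Direction) : Prog :=
  .seq (.setInt 3 (.load (.add (.reg 0) (.reg 1))))
    (.seq (.setInt 4 (.load (.add (.reg 0) (.reg 2))))
      (.seq (.setInt 5 (.reg 1)) (.seq (.setInt 6 (.reg 2)) (coverLoop d))))

/-- The query program: with the query point itself as the first candidate, two passes over the
nodes of the canonical cover. -/
def queryProg (d : Direction) : Prog :=
  .seq (.setReal 2 (.reg 0)) (.seq (.setReal 3 (.reg 1)) (.seq (coverPass d) (coverPass d)))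

/-- `L` collects the candidates for the point sets `Sf v` of the nodes `v` of a list. -/
structure Collects (s : ℝ) (q : ℝ × ℝ) (Sf : ℕ × ℕ → Finset (ℝ × ℝ)) (N : List (ℕ × ℕ))
    (L : List (ℝ × ℝ)) : Prop where
  mem : ∀ x ∈ L, ∃ v ∈ N, x ∈ Sf v
  exists_sublist : ∀ v ∈ N, ∃ L', IsCandidateList s q (Sf v) L' ∧ L' ⊆ L

section Collects

variable {s : ℝ} {q : ℝ × ℝ} {Sf : ℕ × ℕ → Finset (ℝ × ℝ)} {N N₁ N₂ : List (ℕ × ℕ)}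
  {L L₁ L₂ : List (ℝ × ℝ)}

lemma Collects.nil : Collects s q Sf [] [] := ⟨by simp, by simp⟩

lemma Collects.singleton {v : ℕ × ℕ} (h : IsCandidateList s q (Sf v) L) :
    Collects s q Sf [v] L :=
  ⟨fun x hx => ⟨v, by simp, h.mem x hx⟩, fun w hw => ⟨L, by rwa [List.mem_singleton.1 hw],
    List.Subset.refl L⟩⟩

lemma Collects.append (h₁ : Collects s q Sf N₁ L₁) (h₂ : Collects s q Sf N₂ L₂) :
    Collects s q Sf (N₁ ++ N₂) (L₁ ++ L₂) where
  mem x hx := by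
    rcases List.mem_append.1 hx with hx | hx
    · exact (h₁.mem x hx).imp fun v hv => ⟨List.mem_append_left _ hv.1, hv.2⟩
    · exact (h₂.mem x hx).imp fun v hv => ⟨List.mem_append_right _ hv.1, hv.2⟩
  exists_sublist v hv := by
    rcases List.mem_append.1 hv with hv | hv
    · exact (h₁.exists_sublist v hv).imp fun L' hL => ⟨hL.1, fun x hx =>
        List.mem_append_left _ (hL.2 hx)⟩
    · exact (h₂.exists_sublist v hv).imp fun L' hL => ⟨hL.1, fun x hx =>
        List.mem_append_right _ (hL.2 hx)⟩

/-- The candidates collected from the parts of a point set suffice for two passes. -/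
lemma Collects.isTangentPoint (h : Collects s q Sf N L) (hs : s * s = 1) {S : Set (ℝ × ℝ)}
    (hS : S.Finite) (hSN : ∀ x, x ∈ S ↔ ∃ v ∈ N, x ∈ Sf v)
    (hq : q ∈ frontier (convexHull ℝ S)) (hne : ∃ x ∈ S, x ≠ q) :
    IsTangentPoint s S q ((L ++ L).foldl (better s q) q) := by
  have hs0 : s ≠ 0 := by rintro rfl; simp at hs
  refine isTangentPoint_foldl_better hs hS hq hne (fun x hx => (hSN x).2 (h.mem x hx))
    (fun t ht => ?_) fun t htq h0 x hx => ?_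
  · obtain ⟨v, hv, htv⟩ := (hSN t).1 ht.mem
    obtain ⟨L', hL', hsub⟩ := h.exists_sublist v hv
    have hvS : (Sf v : Set (ℝ × ℝ)) ⊆ S := fun x hx => (hSN x).2 ⟨v, hv, hx⟩
    refine hsub (hL'.tangent t ?_ (ht.mono hvS htv))
    exact inter_extremePoints_subset_extremePoints_of_subset (convexHull_mono hvS)
      ⟨subset_convexHull ℝ _ htv, ht.mem_hullVertices hs0 hS⟩
  · obtain ⟨v, hv, hxv⟩ := (hSN x).1 hx
    obtain ⟨L', hL', hsub⟩ := h.exists_sublist v hv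
    exact hL'.line t htq (fun y hy => h0 y (hsub hy)) x hxv

end Collects

/-- The first seven integer registers during the traversal. -/
def rowRegs (A i j a b l r : ℤ) : ℕ → ℤ
  | 0 => A
  | 1 => i
  | 2 => j
  | 3 => a
  | 4 => b
  | 5 => l
  | 6 => r
  | _ => 0

/-- The first seven integer registers have the contents `g`. -/
def Agrees (g ρ : ℕ → ℤ) : Prop := ∀ x < 7, ρ x = g x

section Traversal

variable {M : Memory} {d : Direction} {s : ℝ} {q : ℝ × ℝ} {A : ℤ} {n i j : ℕ}
  {addr : ℕ × ℕ → ℤ} {Sf : ℕ × ℕ → Finset (ℝ × ℝ)} {K : ℕ}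

lemma offers_setInt_agrees {g g' : ℕ → ℤ} {x : ℕ} {e : IExpr} (hx : x < 7)
    (hg : g' = Function.update g x (g' x))
    (he : ∀ σ : State, Agrees g σ.int → e.eval M σ = g' x) :
    Offers M s q (.setInt x e) (e.cost + 1) (Agrees g) (Agrees g') [] := by
  refine Offers.setInt fun σ hσ y hy => ?_
  rw [he σ hσ, hg]
  by_cases hyx : y = x
  · subst hyx; simp
  · rw [Function.update_of_ne hyx, Function.update_of_ne hyx]; exact hσ y hy

lemma offers_offerNodeAt {v : ℕ × ℕ} (hv : StoresHull M (addr v) (Sf v))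
    (hK : (Sf v).card ≤ 2 ^ K) : ∃ L, Collects d.sign q Sf [v] L ∧
    ∀ (g : ℕ → ℤ) (x : ℕ), x < 7 → g x = addr v →
      Offers M d.sign q (offerNodeAt d x) (420 * K + 1217) (Agrees g) (Agrees g) L := by
  obtain ⟨L, hL, hrun⟩ := offers_offerNode d (q := q) hv hK
  refine ⟨L, Collects.singleton hL, fun g x hx hgx => ?_⟩
  have h1 : Offers M d.sign q (.setInt 7 (.reg x)) 2 (Agrees g)
      (fun ρ => (∀ x < 7, ρ x = g x) ∧ ρ 7 = addr v) [] := by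
    refine Offers.setInt fun σ hσ => ⟨fun y hy => ?_, ?_⟩
    · rw [Function.update_of_ne (by omega)]; exact hσ y hy
    · rw [Function.update_self, ← hgx]; exact hσ x hx
  exact (h1.seq (hrun g)).mono (fun _ => id) (fun _ => id) (by omega)

lemma evenTest_holds {σ : State} {x m : ℕ} (h : σ.int x = m) :
    (evenTest x).holds M σ ↔ m % 2 = 0 := by
  simp only [evenTest, Test.holds, IExpr.eval, h]
  omega

lemma rowRegs_update_three (A i j a b l r a' : ℤ) :
    rowRegs A i j a' b l r = Function.update (rowRegs A i j a b l r) 3 a' := by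
  funext x; rcases x with _ | _ | _ | _ | _ | _ | _ | x <;> simp [rowRegs, Function.update]

lemma rowRegs_update_four (A i j a b l r b' : ℤ) :
    rowRegs A i j a b' l r = Function.update (rowRegs A i j a b l r) 4 b' := by
  funext x; rcases x with _ | _ | _ | _ | _ | _ | _ | x <;> simp [rowRegs, Function.update]

lemma rowRegs_update_five (A i j a b l r l' : ℤ) :
    rowRegs A i j a b l' r = Function.update (rowRegs A i j a b l r) 5 l' := by
  funext x; rcases x with _ | _ | _ | _ | _ | _ | _ | x <;> simp [rowRegs, Function.update]

lemma rowRegs_update_six (A i j a b l r r' : ℤ) :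
    rowRegs A i j a b l r' = Function.update (rowRegs A i j a b l r) 6 r' := by
  funext x; rcases x with _ | _ | _ | _ | _ | _ | _ | x <;> simp [rowRegs, Function.update]

lemma offers_leftStep (hM : StoresTree M A n addr) {κ l r : ℕ} (hrow : IsRow n κ l r)
    (hlt : l < r) (hv : l % 2 = 1 → StoresHull M (addr (κ, l)) (Sf (κ, l)))
    (hK : l % 2 = 1 → (Sf (κ, l)).card ≤ 2 ^ K) :
    ∃ L, Collects d.sign q Sf (if l % 2 = 1 then [(κ, l)] else []) L ∧
      Offers M d.sign q (leftStep d) (420 * K + 1250)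
        (Agrees (rowRegs A i j (addr (κ, l)) (addr (κ, r)) l r))
        (Agrees (rowRegs A i j (addr (κ, 2 * ((l + 1) / 2))) (addr (κ, r))
          (2 * ((l + 1) / 2) : ℕ) r)) L := by
  have hcost : (evenTest 5).cost = 7 := rfl
  by_cases hodd : l % 2 = 1
  · obtain ⟨L, hL, hrun⟩ := offers_offerNodeAt (d := d) (q := q) (hv hodd) (hK hodd)
    refine ⟨L, by rwa [if_pos hodd], ?_⟩
    have hl : 2 * ((l + 1) / 2) = l + 1 := by omega
    rw [hl]
    have hnext : M.int (addr (κ, l) + 4) = addr (κ, l + 1) :=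
      hM.next κ l (isNode_of_le hrow.right hlt)
    have s1 := offers_setInt_agrees (M := M) (s := d.sign) (q := q)
      (e := .load (.add (.reg 3) (.const 4))) (by norm_num : 3 < 7)
      (rowRegs_update_three A i j (addr (κ, l)) (addr (κ, r)) l r (addr (κ, l + 1)))
      fun σ hσ => by simp [IExpr.eval, hσ 3 (by norm_num), rowRegs, hnext]
    have s2 := offers_setInt_agrees (M := M) (s := d.sign) (q := q)
      (e := .add (.reg 5) (.const 1)) (by norm_num : 5 < 7)
      (rowRegs_update_five A i j (addr (κ, l + 1)) (addr (κ, r)) l r (l + 1 : ℕ))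
      fun σ hσ => by simp [IExpr.eval, hσ 5 (by norm_num), rowRegs]
    have s3 := (hrun (rowRegs A i j (addr (κ, l)) (addr (κ, r)) l r) 3 (by norm_num) rfl).seq
      (s1.seq s2)
    rw [List.append_nil, List.append_nil] at s3
    refine (Offers.ite False (fun σ hσ _ => ?_) False.elim fun _ => s3).mono (fun _ => id)
      (fun _ => id) (by simp only [hcost, IExpr.cost]; omega)
    rw [evenTest_holds (hσ 5 (by norm_num))]
    simp [hodd]
  · refine ⟨[], by rw [if_neg hodd]; exact Collects.nil, ?_⟩
    have hl : 2 * ((l + 1) / 2) = l := by omega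
    rw [hl]
    refine (Offers.ite True (fun σ hσ _ => ?_) (fun _ => Offers.skip fun _ => id)
      fun h => absurd trivial h).mono (fun _ => id) (fun _ => id) (by omega)
    rw [evenTest_holds (hσ 5 (by norm_num))]
    simp only [iff_true]; omega

lemma offers_rightStep (hM : StoresTree M A n addr) {κ l r : ℕ} (hrow : IsRow n κ l r)
    (hlt : l < r) (hv : r % 2 = 0 → StoresHull M (addr (κ, r)) (Sf (κ, r)))
    (hK : r % 2 = 0 → (Sf (κ, r)).card ≤ 2 ^ K) (a l' : ℤ) :
    ∃ L, Collects d.sign q Sf (if r % 2 = 0 then [(κ, r)] else []) L ∧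
      Offers M d.sign q (rightStep d) (420 * K + 1250)
        (Agrees (rowRegs A i j a (addr (κ, r)) l' r))
        (Agrees (rowRegs A i j a (addr (κ, 2 * ((r - 1) / 2) + 1)) l'
          (2 * ((r - 1) / 2) + 1 : ℕ))) L := by
  have hcost : (evenTest 6).cost = 7 := rfl
  by_cases heven : r % 2 = 0
  · obtain ⟨L, hL, hrun⟩ := offers_offerNodeAt (d := d) (q := q) (hv heven) (hK heven)
    refine ⟨L, by rwa [if_pos heven], ?_⟩
    obtain ⟨r, rfl⟩ : ∃ r', r = r' + 1 := ⟨r - 1, by omega⟩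
    have hr : 2 * ((r + 1 - 1) / 2) + 1 = r := by omega
    rw [hr]
    have hprev : M.int (addr (κ, r + 1) + 3) = addr (κ, r) := hM.prev κ r hrow.right
    have s1 := offers_setInt_agrees (M := M) (s := d.sign) (q := q)
      (e := .load (.add (.reg 4) (.const 3))) (by norm_num : 4 < 7)
      (rowRegs_update_four A i j a (addr (κ, r + 1)) l' (r + 1 : ℕ) (addr (κ, r)))
      fun σ hσ => by simp [IExpr.eval, hσ 4 (by norm_num), rowRegs, hprev]
    have s2 := offers_setInt_agrees (M := M) (s := d.sign) (q := q)
      (e := .sub (.reg 6) (.const 1)) (by norm_num : 6 < 7)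
      (rowRegs_update_six A i j a (addr (κ, r)) l' (r + 1 : ℕ) r)
      fun σ hσ => by simp [IExpr.eval, hσ 6 (by norm_num), rowRegs]
    have s3 := (hrun (rowRegs A i j a (addr (κ, r + 1)) l' (r + 1 : ℕ)) 4 (by norm_num) rfl).seq
      (s1.seq s2)
    rw [List.append_nil, List.append_nil] at s3
    refine (Offers.ite True (fun σ hσ _ => ?_) (fun _ => s3) fun h => absurd trivial h).mono
      (fun _ => id) (fun _ => id) (by simp only [hcost, IExpr.cost]; omega)
    rw [evenTest_holds (hσ 6 (by norm_num))]
    simp [heven]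
  · refine ⟨[], by rw [if_neg heven]; exact Collects.nil, ?_⟩
    have hr : 2 * ((r - 1) / 2) + 1 = r := by omega
    rw [hr]
    refine (Offers.ite False (fun σ hσ _ => ?_) False.elim
      fun _ => Offers.skip fun _ => id).mono (fun _ => id) (fun _ => id) (by omega)
    rw [evenTest_holds (hσ 6 (by norm_num))]
    simpa using heven

lemma offers_parentStep {κ m m' : ℕ} (hm : M.int (addr (κ, 2 * m)) = addr (κ + 1, m))
    (hm' : M.int (addr (κ, 2 * m' + 1)) = addr (κ + 1, m')) :
    Offers M s q parentStep 20
      (Agrees (rowRegs A i j (addr (κ, 2 * m)) (addr (κ, 2 * m' + 1)) (2 * m : ℕ)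
        (2 * m' + 1 : ℕ)))
      (Agrees (rowRegs A i j (addr (κ + 1, m)) (addr (κ + 1, m')) m m')) [] := by
  have s1 := offers_setInt_agrees (M := M) (s := s) (q := q) (e := .load (.reg 3))
    (by norm_num : 3 < 7) (rowRegs_update_three A i j (addr (κ, 2 * m)) (addr (κ, 2 * m' + 1))
      (2 * m : ℕ) (2 * m' + 1 : ℕ) (addr (κ + 1, m)))
    fun σ hσ => by simp [IExpr.eval, hσ 3 (by norm_num), rowRegs, hm]
  have s2 := offers_setInt_agrees (M := M) (s := s) (q := q) (e := .load (.reg 4))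
    (by norm_num : 4 < 7) (rowRegs_update_four A i j (addr (κ + 1, m)) (addr (κ, 2 * m' + 1))
      (2 * m : ℕ) (2 * m' + 1 : ℕ) (addr (κ + 1, m')))
    fun σ hσ => by simp [IExpr.eval, hσ 4 (by norm_num), rowRegs, hm']
  have s3 := offers_setInt_agrees (M := M) (s := s) (q := q) (e := .half (.reg 5))
    (by norm_num : 5 < 7) (rowRegs_update_five A i j (addr (κ + 1, m)) (addr (κ + 1, m'))
      (2 * m : ℕ) (2 * m' + 1 : ℕ) m)
    fun σ hσ => by simp [IExpr.eval, hσ 5 (by norm_num), rowRegs]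
  have s4 := offers_setInt_agrees (M := M) (s := s) (q := q) (e := .half (.reg 6))
    (by norm_num : 6 < 7) (rowRegs_update_six A i j (addr (κ + 1, m)) (addr (κ + 1, m'))
      m (2 * m' + 1 : ℕ) m')
    fun σ hσ => by simp only [IExpr.eval, hσ 6 (by norm_num), rowRegs]; omega
  exact (s1.seq (s2.seq (s3.seq s4))).mono (fun _ => id) (fun _ => id)
    (by simp only [IExpr.cost]; omega)

/-- The registers that survive the traversal. -/
def Window (A i j : ℤ) (ρ : ℕ → ℤ) : Prop := ρ 0 = A ∧ ρ 1 = i ∧ ρ 2 = j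

lemma window_of_agrees {A i j a b l r : ℤ} {ρ : ℕ → ℤ} (h : Agrees (rowRegs A i j a b l r) ρ) :
    Window A i j ρ := ⟨h 0 (by norm_num), h 1 (by norm_num), h 2 (by norm_num)⟩

lemma offers_coverLoop_of_gt {a b : ℤ} {l r : ℕ} (h : r < l) :
    Offers M s q (coverLoop d) 4 (Agrees (rowRegs A i j a b l r)) (Window A i j) [] := by
  refine Offers.loop_done (fun σ hσ => ?_) fun ρ => window_of_agrees
  simp [Test.holds, IExpr.eval, hσ 5 (by norm_num), hσ 6 (by norm_num), rowRegs, h]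

lemma offers_coverLoop (hM : StoresTree M A n addr) (k : ℕ) : ∀ κ l r : ℕ, r + 1 - l ≤ 2 ^ k →
    IsRow n κ l r → (∀ v ∈ coverNodes κ l r, StoresHull M (addr v) (Sf v)) →
    (∀ v ∈ coverNodes κ l r, (Sf v).card ≤ 2 ^ K) →
    ∃ L, Collects d.sign q Sf (coverNodes κ l r) L ∧
      Offers M d.sign q (coverLoop d) ((840 * K + 2550) * k + (420 * K + 1250))
        (Agrees (rowRegs A i j (addr (κ, l)) (addr (κ, r)) l r)) (Window A i j) L := by
  have hcond : ∀ {a b : ℤ} {l r : ℕ}, l ≤ r → ∀ σ : State,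
      Agrees (rowRegs A i j a b l r) σ.int → (Test.ile (.reg 5) (.reg 6)).holds M σ := by
    intro a b l r h σ hσ
    simp [Test.holds, IExpr.eval, hσ 5 (by norm_num), hσ 6 (by norm_num), rowRegs, h]
  have hbase : ∀ k κ l r : ℕ, r ≤ l → IsRow n κ l r →
      (∀ v ∈ coverNodes κ l r, StoresHull M (addr v) (Sf v)) →
      (∀ v ∈ coverNodes κ l r, (Sf v).card ≤ 2 ^ K) →
      ∃ L, Collects d.sign q Sf (coverNodes κ l r) L ∧
        Offers M d.sign q (coverLoop d) ((840 * K + 2550) * k + (420 * K + 1250))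
          (Agrees (rowRegs A i j (addr (κ, l)) (addr (κ, r)) l r)) (Window A i j) L := by
    intro k κ l r hle hrow hv hK
    rcases hle.eq_or_lt with rfl | hgt
    · rw [coverNodes_self] at hv hK ⊢
      obtain ⟨L, hL, hrun⟩ := offers_offerNodeAt (d := d) (q := q) (hv (κ, r) (by simp))
        (hK (κ, r) (by simp))
      refine ⟨L, hL, ?_⟩
      have s1 := hrun (rowRegs A i j (addr (κ, r)) (addr (κ, r)) r r) 3 (by norm_num) rfl
      have s2 := offers_setInt_agrees (M := M) (s := d.sign) (q := q)
        (e := .add (.reg 5) (.const 1)) (by norm_num : 5 < 7)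
        (rowRegs_update_five A i j (addr (κ, r)) (addr (κ, r)) r r (r + 1 : ℕ))
        fun σ hσ => by simp [IExpr.eval, hσ 5 (by norm_num), rowRegs]
      have s3 : Offers M d.sign q (levelStep d) _ _ _ _ := Offers.ite
        (Q := .seq (leftStep d) (.seq (rightStep d) parentStep))
        (b := .ile (.reg 6) (.reg 5)) True (fun σ hσ _ => by
          simp [Test.holds, IExpr.eval, hσ 5 (by norm_num), hσ 6 (by norm_num), rowRegs])
        (fun _ => s1.seq s2) fun h => absurd trivial h
      have s4 := Offers.loop_step (hcond le_rfl) s3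
        (offers_coverLoop_of_gt (d := d) (Nat.lt_succ_self r))
      rw [List.append_nil, List.append_nil] at s4
      refine s4.mono (fun _ => id) (fun _ => id) ?_
      simp only [Test.cost, IExpr.cost]
      have := Nat.zero_le ((840 * K + 2550) * k)
      omega
    · rw [coverNodes_of_gt hgt]
      exact ⟨[], Collects.nil, (offers_coverLoop_of_gt hgt).mono (fun _ => id) (fun _ => id)
        (by have := Nat.zero_le ((840 * K + 2550) * k); omega)⟩
  induction k with
  | zero =>
    intro κ l r hk
    rw [pow_zero] at hk
    exact hbase 0 κ l r (by omega)
  | succ k ih =>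
    intro κ l r hk hrow hv hK
    rcases le_or_gt r l with hle | hlt
    · exact hbase (k + 1) κ l r hle hrow hv hK
    rw [coverNodes_of_lt hlt] at hv hK ⊢
    rw [pow_succ] at hk
    have hpar := hrow.parents hlt
    obtain ⟨L₁, hL₁, s1⟩ := offers_leftStep (d := d) (q := q) (i := i) (j := j) (Sf := Sf) (K := K)
      hM hrow hlt (fun h => hv _ (by simp [h])) (fun h => hK _ (by simp [h]))
    obtain ⟨L₂, hL₂, s2⟩ := offers_rightStep (d := d) (q := q) (i := i) (j := j) (Sf := Sf) (K := K)
      hM hrow hlt (fun h => hv _ (by simp [h])) (fun h => hK _ (by simp [h]))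
      (addr (κ, 2 * ((l + 1) / 2))) (2 * ((l + 1) / 2) : ℕ)
    obtain ⟨L₃, hL₃, s4⟩ := ih (κ + 1) ((l + 1) / 2) ((r - 1) / 2) (by omega) hpar
      (fun v h => hv v (List.mem_append_right _ (List.mem_append_right _ h)))
      (fun v h => hK v (List.mem_append_right _ (List.mem_append_right _ h)))
    have s3 := offers_parentStep (M := M) (addr := addr) (s := d.sign) (q := q) (A := A) (i := i)
      (j := j) (κ := κ) (m := (l + 1) / 2) (m' := (r - 1) / 2)
      (by
        have := hM.parent κ (2 * ((l + 1) / 2)) (isNode_of_le hrow.right (by omega))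
        rw [show 2 * ((l + 1) / 2) / 2 = (l + 1) / 2 by omega] at this
        exact this hpar.left)
      (by
        have := hM.parent κ (2 * ((r - 1) / 2) + 1) (isNode_of_le hrow.right (by omega))
        rw [show (2 * ((r - 1) / 2) + 1) / 2 = (r - 1) / 2 by omega] at this
        exact this hpar.right)
    refine ⟨L₁ ++ (L₂ ++ L₃), hL₁.append (hL₂.append hL₃), ?_⟩
    have s5 : Offers M d.sign q (levelStep d) _ _ _ _ := Offers.ite
      (P := .seq (offerNodeAt d 3) (.setInt 5 (.add (.reg 5) (.const 1))))
      (b := .ile (.reg 6) (.reg 5)) False (fun σ hσ _ => by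
        simp [Test.holds, IExpr.eval, hσ 5 (by norm_num), hσ 6 (by norm_num), rowRegs, hlt])
      False.elim (fun _ => s1.seq (s2.seq s3))
    have s6 := Offers.loop_step (hcond hlt.le) s5 s4
    rw [List.append_nil, List.append_assoc] at s6
    refine s6.mono (fun _ => id) (fun _ => id) ?_
    simp only [Test.cost, IExpr.cost]
    have : (840 * K + 2550) * (k + 1) = (840 * K + 2550) * k + (840 * K + 2550) := by ring
    omega

lemma offers_coverPass (hM : StoresTree M A n addr) (hij : i < j) (hj : j < n)
    (hK : j + 1 - i ≤ 2 ^ K)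
    (hv : ∀ v ∈ coverNodes 0 i j, StoresHull M (addr v) (Sf v))
    (hcard : ∀ v ∈ coverNodes 0 i j, (Sf v).card ≤ 2 ^ K) :
    ∃ L, Collects d.sign q Sf (coverNodes 0 i j) L ∧
      Offers M d.sign q (coverPass d) ((840 * K + 2550) * K + (420 * K + 1270))
        (Window A i j) (Window A i j) L := by
  have hrow : IsRow n 0 i j := ⟨⟨Nat.zero_le _, by simpa using hij.trans hj⟩,
    ⟨Nat.zero_le _, by simpa using hj⟩, by omega⟩
  obtain ⟨L, hL, hrun⟩ := offers_coverLoop (d := d) (q := q) (i := i) (j := j) hM K 0 i j hK hrow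
    hv hcard
  refine ⟨L, hL, ?_⟩
  have hi := hM.leaf i (hij.trans hj)
  have hj := hM.leaf j hj
  have s1 : Offers M d.sign q (.setInt 3 (.load (.add (.reg 0) (.reg 1)))) 5 (Window A i j)
      (fun ρ => Window A i j ρ ∧ ρ 3 = addr (0, i)) [] :=
    Offers.setInt fun σ ⟨h0, h1, h2⟩ => by
      simp [Window, IExpr.eval, Function.update, h0, h1, h2, hi]
  have s2 : Offers M d.sign q (.setInt 4 (.load (.add (.reg 0) (.reg 2)))) 5
      (fun ρ => Window A i j ρ ∧ ρ 3 = addr (0, i))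
      (fun ρ => Window A i j ρ ∧ ρ 3 = addr (0, i) ∧ ρ 4 = addr (0, j)) [] :=
    Offers.setInt fun σ ⟨⟨h0, h1, h2⟩, h3⟩ => by
      simp [Window, IExpr.eval, Function.update, h0, h1, h2, h3, hj]
  have s3 : Offers M d.sign q (.setInt 5 (.reg 1)) 2
      (fun ρ => Window A i j ρ ∧ ρ 3 = addr (0, i) ∧ ρ 4 = addr (0, j))
      (fun ρ => Window A i j ρ ∧ ρ 3 = addr (0, i) ∧ ρ 4 = addr (0, j) ∧ ρ 5 = i) [] :=
    Offers.setInt fun σ ⟨⟨h0, h1, h2⟩, h3, h4⟩ => by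
      simp [Window, IExpr.eval, Function.update, h0, h1, h2, h3, h4]
  have s4 : Offers M d.sign q (.setInt 6 (.reg 2)) 2
      (fun ρ => Window A i j ρ ∧ ρ 3 = addr (0, i) ∧ ρ 4 = addr (0, j) ∧ ρ 5 = i)
      (Agrees (rowRegs A i j (addr (0, i)) (addr (0, j)) i j)) [] :=
    Offers.setInt fun σ ⟨⟨h0, h1, h2⟩, h3, h4, h5⟩ x hx => by
      interval_cases x <;> simp [IExpr.eval, Function.update, rowRegs, h0, h1, h2, h3, h4, h5]
  exact (s1.seq (s2.seq (s3.seq (s4.seq hrun)))).mono (fun _ => id) (fun _ => id) (by omega)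

end Traversal

/-- The query program returns a tangent point. -/
lemma run_queryProg {M : Memory} {A : ℤ} {n i j K : ℕ} {addr : ℕ × ℕ → ℤ} {p : ℕ → ℝ × ℝ}
    (hM : StoresTree M A n addr) (hij : i < j) (hj : j < n) (hK : j + 1 - i ≤ 2 ^ K)
    (hv : ∀ v ∈ coverNodes 0 i j, StoresHull M (addr v) (p '' (canonicalSubset n v : Set ℕ)))
    (d : Direction) {q : ℝ × ℝ} (hq : q ∈ frontier (convexHull ℝ (p '' Set.Icc i j)))
    (hne : ∃ e ∈ Set.Icc i j, p e ≠ q) :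
    ∃ (t : ℕ) (σ : State), Run M (queryProg d) (queryStart A i j q) t σ ∧
      t ≤ 6000 * (K + 1) ^ 2 ∧ IsTangentPoint d.sign (p '' Set.Icc i j) q (σ.real 0, σ.real 1) := by
  have hunion := biUnion_coverNodes hij.le hj
  obtain ⟨L, hL, hpass⟩ := offers_coverPass (M := M) (d := d) (q := q)
    (Sf := fun v => (canonicalSubset n v).image p) (K := K) hM hij hj hK
    (fun v h => by rw [Finset.coe_image]; exact hv v h) fun v h => by
      refine Finset.card_image_le.trans ((Finset.card_le_card (t := Finset.Icc i j) ?_).trans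
        (by rwa [Nat.card_Icc]))
      rw [← hunion]
      exact Finset.subset_biUnion_of_mem (canonicalSubset n) (List.mem_toFinset.2 h)
  let σ₁ : State := { queryStart A i j q with
    real := Function.update (Function.update (queryStart A i j q).real 2 q.1) 3 q.2 }
  obtain ⟨t, σ, hrun, ht, -, -, hres⟩ := (hpass.seq hpass) σ₁ ⟨rfl, rfl, rfl⟩ rfl
  refine ⟨_, σ, .seq (.setReal _ _ _) (.seq (.setReal _ _ _) hrun), ?_, ?_⟩
  · simp only [RExpr.cost]
    nlinarith
  · have h0 : σ₁.point 0 = q := rfl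
    rw [h0] at hres
    change IsTangentPoint d.sign (p '' Set.Icc i j) q (σ.point 0)
    rw [hres]
    refine hL.isTangentPoint d.sign_mul_self ((Set.finite_Icc i j).image p) (fun x => ?_) hq
      (by obtain ⟨e, he, hpe⟩ := hne; exact ⟨p e, ⟨e, he, rfl⟩, hpe⟩)
    simp only [Set.mem_image, Finset.mem_image]
    constructor
    · rintro ⟨e, he, rfl⟩
      rw [← Finset.coe_Icc, Finset.mem_coe, ← hunion, Finset.mem_biUnion] at he
      obtain ⟨v, hv, hev⟩ := he
      exact ⟨v, List.mem_toFinset.1 hv, e, hev, rfl⟩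
    · rintro ⟨v, hv, e, hev, rfl⟩
      refine ⟨e, ?_, rfl⟩
      rw [← Finset.coe_Icc, Finset.mem_coe, ← hunion, Finset.mem_biUnion]
      exact ⟨v, List.mem_toFinset.2 hv, hev⟩

lemma clog_succ_le_log {w : ℕ} (hw : 2 ≤ w) : ((Nat.clog 2 w + 1 : ℕ) : ℝ) ≤ 5 * Real.log w := by
  have hpow : 2 ^ (Nat.clog 2 w - 1) ≤ w := (Nat.pow_pred_clog_lt_self one_lt_two (by omega)).le
  have hpos : 0 < Nat.clog 2 w := Nat.clog_pos one_lt_two hw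
  obtain ⟨k, hk⟩ : ∃ k, Nat.clog 2 w = k + 1 := ⟨Nat.clog 2 w - 1, by omega⟩
  rw [hk] at hpow ⊢
  have h1 : (k : ℝ) * Real.log 2 ≤ Real.log w := by
    rw [← Real.log_pow]
    exact Real.log_le_log (by positivity) (by exact_mod_cast hpow)
  have h2 : Real.log 2 ≤ Real.log w := Real.log_le_log (by norm_num) (by exact_mod_cast hw)
  have h3 := Real.log_two_gt_d9
  have h4 : (0 : ℝ) ≤ k := Nat.cast_nonneg k
  push_cast
  nlinarith

end GiftWrap

theorem mainTheorem2 :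
    ∃ (P : GiftWrap.Direction → GiftWrap.Prog) (C : ℝ),
      ∀ (n i j : ℕ), i < j → j < n →
        ∃ N : Finset (ℕ × ℕ),
          (∀ v ∈ N, GiftWrap.IsNode n v) ∧
          N.biUnion (GiftWrap.canonicalSubset n) = Finset.Icc i j ∧
          (N.card : ℝ) ≤ C * Real.log ((j : ℝ) - i + 1) ∧
          ∀ (p : ℕ → ℝ × ℝ) (M : GiftWrap.Memory) (A : ℤ) (addr : ℕ × ℕ → ℤ),
            GiftWrap.StoresTree M A n addr →
            (∀ v ∈ N, GiftWrap.StoresHull M (addr v)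
              (p '' (GiftWrap.canonicalSubset n v : Set ℕ))) →
            ∀ (d : GiftWrap.Direction) (q : ℝ × ℝ),
              q ∈ frontier (convexHull ℝ (p '' Set.Icc i j)) →
              (∃ e ∈ Set.Icc i j, p e ≠ q) →
              ∃ (t : ℕ) (s : GiftWrap.State),
                GiftWrap.Run M (P d) (GiftWrap.queryStart A i j q) t s ∧
                (t : ℝ) ≤ C * Real.log ((j : ℝ) - i + 1) ^ 2 ∧
                GiftWrap.IsHullNeighbor d (p '' Set.Icc i j) q (s.real 0, s.real 1) := by
  refine ⟨GiftWrap.queryProg, 6000 * 25, fun n i j hij hj =>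
    ⟨(GiftWrap.coverNodes 0 i j).toFinset, ?_, GiftWrap.biUnion_coverNodes hij.le hj, ?_, ?_⟩⟩
  · intro v hv
    refine GiftWrap.isNode_of_mem_coverNodes 0 i j ⟨⟨Nat.zero_le _, ?_⟩, ⟨Nat.zero_le _, ?_⟩,
      by omega⟩ v (List.mem_toFinset.1 hv)
    · simpa using hij.trans hj
    · simpa using hj
  all_goals
    have hw : ((j + 1 - i : ℕ) : ℝ) = (j : ℝ) - i + 1 := by
      rw [Nat.cast_sub (by omega)]; push_cast; ring
    have hK : j + 1 - i ≤ 2 ^ Nat.clog 2 (j + 1 - i) := Nat.le_pow_clog one_lt_two _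
    have hlog := GiftWrap.clog_succ_le_log (w := j + 1 - i) (by omega)
    rw [hw] at hlog
    generalize Nat.clog 2 (j + 1 - i) = K at hK hlog
  · have h1 := (List.toFinset_card_le (GiftWrap.coverNodes 0 i j)).trans
      (GiftWrap.length_coverNodes_le K 0 i j hK)
    have h2 : ((GiftWrap.coverNodes 0 i j).toFinset.card : ℝ) ≤ 2 * ((K + 1 : ℕ) : ℝ) := by
      exact_mod_cast h1.trans (by omega)
    have h3 : (0 : ℝ) ≤ ((K + 1 : ℕ) : ℝ) := Nat.cast_nonneg _
    linarith
  · intro p M A addr hM hv d q hq hne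
    obtain ⟨t, s, hrun, ht, hres⟩ := GiftWrap.run_queryProg hM hij hj hK
      (fun v h => hv v (List.mem_toFinset.2 h)) d hq hne
    refine ⟨t, s, hrun, ?_, hres.isHullNeighbor ((Set.finite_Icc i j).image p)⟩
    have h1 : (t : ℝ) ≤ 6000 * ((K + 1 : ℕ) : ℝ) ^ 2 := by exact_mod_cast ht
    have h2 := pow_le_pow_left₀ (Nat.cast_nonneg (K + 1)) hlog 2
    rw [mul_pow] at h2
    linarith
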